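/- Let $H$ be a complex Hilbert space, $\mathcal I_1$ the space of trace class operators on $H$, and $\mathcal F_0$ the space of bounded Fredholm operators on $H$ of index zero, with the operator norm topology. For an operator $S$ with $S-\mathrm{Id}\in\mathcal I_1$ let $\det_F S$ be its Fredholm determinant, i.e. the extension of $\det(\mathrm{Id}+F)$, $F$ of finite rank, by continuity in the trace norm. For $A,B\in\mathcal I_1$ put $$\mathcal U_A=\{T\in\mathcal F_0 : T+A \text{ is invertible}\},\qquad g_{A,B}(T)={\det}_F\{(T+A)(T+B)^{-1}\}\quad (T\in\mathcal U_A\cap\mathcal U_B).$$ For $T\in\mathcal F_0$ let $\mathcal A_T=\{A\in\mathcal I_1 : T+A\text{ is invertible}\}$ and $$\mathcal D_T=\{f:\mathcal A_T\to\mathbb C \;:\; f(B)=g_{A,B}(T)\,f(A)\ \text{ for all } A,B\in\mathcal A_T\}.$$ Let $\pi_T$ be the orthogonal projection of $H$ onto $\operatorname{Ker}T$, let $\rho_T:H\to\operatorname{Coker}T=H/\operatorname{Ran}T$ be the quotient map, and let $d=\dim\operatorname{Ker}T=\dim\operatorname{Coker}T$. Call a linear map $L:\operatorname{Ker}T\to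 H$ admissible if $\rho_T\circ L:\operatorname{Ker}T\to\operatorname{Coker}T$ is an isomorphism. For $A\in\mathcal A_T$, $L$ admissible and a basis $e_1,\dots,e_d$ of $\operatorname{Ker}T$ with dual basis $e_1^*,\dots,e_d^*$, define $$\phi_T:\mathcal D_T\to \wedge^{d}(\operatorname{Ker}T)^*\otimes\wedge^{d}\operatorname{Coker}T,$$ $$\phi_T(f)=f(A)\,{\det}_F\{(T+A)(T+L\circ\pi_T)^{-1}\}\; e_1^*\wedge\cdots\wedge e_d^*\otimes\rho_T(L(e_1))\wedge\cdots\wedge\rho_T(L(e_d)).$$ Then: (1) For every $T\in\mathcal F_0$ an admissible $L$ exists, $L\circ\pi_T\in\mathcal A_T$ for every admissible $L$, and $\dim_{\mathbb C}\mathcal D_T=1$. (2) The map $\phi_T$ depends neither on the choice of $A\in\mathcal A_T$, nor on the choice of the admissible map $L$, nor on the choice of the basis $\{e_i\}$ of $\operatorname{Ker}T$, and it is a linear isomorphism. (3) The functions $g_{A,B}$ are holomorphic on $\mathcal U_A\cap\mathcal U_B$, and $\{\mathcal U_A\}$, $\{g_{A,B}\}$ $(A,B\in\mathcal I_1)$ are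 an open covering of $\mathcal F_0$ and a cocycle of transition functions on it (coordinates over $\mathcal U_A$ are multiplied by $g_{A,B}$ to give coordinates over $\mathcal U_B$); they define a complex line bundle $\mathcal L_F$, the Determinant line bundle. The family $\coprod_{T\in\mathcal F_0}\mathcal D_T$ has a complex line bundle structure with local trivializations $j_A: f\mapsto (T,f(A))$, $f\in\mathcal D_T$, $T\in\mathcal U_A$, and is isomorphic to $\mathcal L_F$ by an isomorphism that takes the trivialization of $\mathcal L_F$ over $\mathcal U_A$ to $j_A$ for every $A$. (4) The family $\mathcal L_Q=\coprod_{T\in\mathcal F_0}\wedge^{\max}(\operatorname{Ker}T)^*\otimes\wedge^{\max}\operatorname{Coker}T$ (the Quillen determinant line bundle) has a complex line bundle structure over $\mathcal F_0$ in which, for every $A\in\mathcal I_1$, $\bigl(\coprod_{T\in\mathcal U_A}\phi_T\bigr)\circ j_A^{-1}:\mathcal U_A\times\mathbb C\to\coprod_{T\in\mathcal U_A}\wedge^{\max}(\operatorname{Ker}T)^*\otimes\wedge^{\max}\operatorname{Coker}T$ is the inverse of a local trivialization. With it, $\coprod_T\phi_T:\coprod_{T}\mathcal D_T\to\mathcal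 L_Q$ is an isomorphism of complex line bundles, and hence $\mathcal L_Q\cong\mathcal L_F$. -/

import Mathlib

open scoped TensorProduct InnerProductSpace ENNReal
open Filter Topology Bundle

noncomputable section

namespace DetLine

universe u

variable {H : Type u} [NormedAddCommGroup H] [InnerProductSpace ℂ H] [CompleteSpace H]

/-! ### Trace class operators and the Fredholm determinant -/

/-- The index set of some Hilbert basis of `H`. -/
def basisIndex (H : Type u) [NormedAddCommGroup H] [InnerProductSpace ℂ H] [CompleteSpace H] :
    Set H :=
  (exists_hilbertBasis ℂ H).choose

/-- Some Hilbert basis of `H`. -/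
def hilbertBasis (H : Type u) [NormedAddCommGroup H] [InnerProductSpace ℂ H] [CompleteSpace H] :
    HilbertBasis (basisIndex H) ℂ H :=
  (exists_hilbertBasis ℂ H).choose_spec.choose

/-- The trace norm `‖K‖₁ = Tr |K| = ∑ i, ⟪b i, |K| (b i)⟫` with `|K| = (K* K)^{1/2}`, computed in a
Hilbert basis `b` (the value does not depend on it); it is `∞` if the series diverges. -/
def traceNorm (K : H →L[ℂ] H) : ℝ≥0∞ :=
  ∑' i, ENNReal.ofReal (RCLike.re ⟪hilbertBasis H i, CFC.abs K (hilbertBasis H i)⟫_ℂ)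

/-- `K` is a trace class operator. -/
def IsTraceClass (K : H →L[ℂ] H) : Prop :=
  traceNorm K < ∞

/-- The space `𝓘₁` of trace class operators. -/
abbrev TraceClass (H : Type u) [NormedAddCommGroup H] [InnerProductSpace ℂ H] [CompleteSpace H] :
    Type u :=
  {K : H →L[ℂ] H // IsTraceClass K}

/-- For `F` of finite rank, `det (Id + F)`: the determinant of the restriction of `Id + F` to the
finite-dimensional invariant subspace `range F` (`Id + F` induces the identity on the quotient). -/
def finiteRankDet (F : H →L[ℂ] H) : ℂ :=
  LinearMap.det (LinearMap.id + (F : H →ₗ[ℂ] H).rangeRestrict ∘ₗ F.range.subtype)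

/-- The filter of finite rank operators `F` converging to `K` in trace norm. -/
def finiteRankApprox (K : H →L[ℂ] H) : Filter (H →L[ℂ] H) :=
  comap (fun F => traceNorm (K - F)) (𝓝 0) ⊓ 𝓟 {F | FiniteDimensional ℂ F.range}

/-- The Fredholm determinant of an operator `S` for which `S - Id` is trace class: the extension
of the determinant of operators `Id + F`, `F` of finite rank, by continuity in the trace norm. -/
def fredholmDet (S : H →L[ℂ] H) : ℂ :=
  limUnder (finiteRankApprox (S - 1)) finiteRankDet

/-! ### Fredholm operators of index zero -/

/-- The space `𝓕₀` of Fredholm operators on `H` of index zero (with the operator norm topology). -/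
abbrev FredholmZero (H : Type u) [NormedAddCommGroup H] [InnerProductSpace ℂ H] [CompleteSpace H] :
    Type u :=
  {T : H →L[ℂ] H // T.IsFredholm ∧
    Module.finrank ℂ T.ker = Module.finrank ℂ (H ⧸ T.range)}

/-- The kernel of `T`. -/
abbrev Ker (T : FredholmZero H) : Submodule ℂ H := T.1.ker

/-- The cokernel of `T`. -/
abbrev Coker (T : FredholmZero H) : Type u := H ⧸ T.1.range

/-- `d = dim Ker T`. -/
abbrev dimKer (T : FredholmZero H) : ℕ := Module.finrank ℂ (Ker T)

/-- `dim Coker T`. -/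
abbrev dimCoker (T : FredholmZero H) : ℕ := Module.finrank ℂ (Coker T)

/-- The natural projection `ρ_T : H → Coker T`. -/
abbrev rho (T : FredholmZero H) : H →ₗ[ℂ] Coker T := T.1.range.mkQ

instance (T : FredholmZero H) : FiniteDimensional ℂ (Ker T) := T.2.1.finite_ker

/-- The set `𝓐_T` of trace class operators `A` such that `T + A` is invertible. -/
def regularizers (T : FredholmZero H) : Set (H →L[ℂ] H) :=
  {A | IsTraceClass A ∧ IsUnit (T.1 + A)}

/-- The open set `𝓤_A` of all `T ∈ 𝓕₀` such that `T + A` is invertible. -/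
def chartDomain (A : TraceClass H) : Set (FredholmZero H) :=
  {T | IsUnit (T.1 + A.1)}

/-- `g_{A,B}(T) = det_F ((T + A) (T + B)⁻¹)`. -/
def cocycle (A B T : H →L[ℂ] H) : ℂ :=
  fredholmDet ((T + A) * Ring.inverse (T + B))

/-- The space `𝓓_T` of functions `f : 𝓐_T → ℂ` with `f(B) = det_F ((T + A) (T + B)⁻¹) f(A)`. -/
def detSpace (T : FredholmZero H) : Submodule ℂ (regularizers T → ℂ) where
  carrier := {f | ∀ A B : regularizers T, f B = cocycle A.1 B.1 T.1 * f A}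
  zero_mem' := by intro A B; simp
  add_mem' := by
    intro f g hf hg A B
    rw [Pi.add_apply, Pi.add_apply, hf A B, hg A B, mul_add]
  smul_mem' := by
    intro c f hf A B
    rw [Pi.smul_apply, Pi.smul_apply, hf A B, smul_eq_mul, smul_eq_mul]
    ring

/-- The fibres of the family `∐ 𝓓_T` over `𝓕₀`. -/
abbrev DetFiber (T : FredholmZero H) : Type u := detSpace T

/-- The Quillen line `⋀^{dim Ker T} (Ker T)* ⊗ ⋀^{dim Coker T} Coker T`. -/
abbrev QuillenFiber (T : FredholmZero H) : Type u :=
  (⋀[ℂ]^(dimKer T) (Module.Dual ℂ (Ker T))) ⊗[ℂ] (⋀[ℂ]^(dimCoker T) (Coker T))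

/-! ### The map `φ_T` -/

/-- The condition on the auxiliary map `L : Ker T → H`: `ρ_T ∘ L` is an isomorphism. -/
def IsAdmissible (T : FredholmZero H) (L : Ker T →ₗ[ℂ] H) : Prop :=
  Function.Bijective (rho T ∘ₗ L)

/-- The operator `L ∘ π_T`, where `π_T` is the orthogonal projection onto `Ker T`. -/
def extendByZero (T : FredholmZero H) (L : Ker T →ₗ[ℂ] H) : H →L[ℂ] H :=
  LinearMap.toContinuousLinearMap L ∘L (Ker T).orthogonalProjectionOnto

/-- The vector `e₁* ∧ ⋯ ∧ e_d* ⊗ ρ_T(L e₁) ∧ ⋯ ∧ ρ_T(L e_d)` of the Quillen line, with `e_i*` the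
dual basis. -/
def quillenVector (T : FredholmZero H) (L : Ker T →ₗ[ℂ] H)
    (e : Module.Basis (Fin (dimKer T)) ℂ (Ker T)) : QuillenFiber T :=
  exteriorPower.ιMulti ℂ (dimKer T) (fun i => e.coord i) ⊗ₜ[ℂ]
    exteriorPower.ιMulti ℂ (dimCoker T) (fun i => rho T (L (e (Fin.cast T.2.2.symm i))))

/-- The map `φ_T` built from `A ∈ 𝓐_T`, the map `L` and the basis `e` of `Ker T`:
`f ↦ f(A) det_F ((T + A) (T + L ∘ π_T)⁻¹) e₁* ∧ ⋯ ∧ e_d* ⊗ ρ_T(L e₁) ∧ ⋯ ∧ ρ_T(L e_d)`. -/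
def phi (T : FredholmZero H) (A : regularizers T) (L : Ker T →ₗ[ℂ] H)
    (e : Module.Basis (Fin (dimKer T)) ℂ (Ker T)) : DetFiber T →ₗ[ℂ] QuillenFiber T where
  toFun f := (f.1 A * cocycle A.1 (extendByZero T L) T.1) • quillenVector T L e
  map_add' f g := by
    rw [← add_smul, ← add_mul]
    rfl
  map_smul' c f := by
    rw [RingHom.id_apply, smul_smul, ← mul_assoc]
    rfl

/-! ### Complex line bundles -/

/-- The structure of a complex line bundle on a family `E` of complex vector spaces over `B`. -/
structure LineBundleStructure {B : Type*} [TopologicalSpace B] (E : B → Type*)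
    [∀ b, AddCommGroup (E b)] [∀ b, Module ℂ (E b)] where
  [totalTopology : TopologicalSpace (TotalSpace ℂ E)]
  [fiberTopology : ∀ b, TopologicalSpace (E b)]
  [fiberBundle : FiberBundle ℂ E]
  [vectorBundle : VectorBundle ℂ ℂ E]

section Bundles

variable {B : Type*} [TopologicalSpace B]
  {E : B → Type*} [∀ b, AddCommGroup (E b)] [∀ b, Module ℂ (E b)]
  {E' : B → Type*} [∀ b, AddCommGroup (E' b)] [∀ b, Module ℂ (E' b)]

/-- The maps `c b : E b → ℂ`, for `b ∈ U`, form a local trivialization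
`(b, x) ↦ (b, c b x)` over `U` belonging to the atlas of the line bundle. -/
def LineBundleStructure.HasTrivialization (S : LineBundleStructure E) (U : Set B)
    (c : ∀ b ∈ U, E b → ℂ) : Prop :=
  letI := S.totalTopology
  letI := S.fiberTopology
  letI := S.fiberBundle
  ∃ e ∈ trivializationAtlas ℂ E, e.baseSet = U ∧
    ∀ (b : B) (hb : b ∈ U) (x : E b), e ⟨b, x⟩ = (b, c b hb x)

/-- The fibrewise linear isomorphisms `ψ b` form an isomorphism of line bundles over `B`. -/
def IsLineBundleIso (S : LineBundleStructure E) (S' : LineBundleStructure E')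
    (ψ : ∀ b, E b ≃ₗ[ℂ] E' b) : Prop :=
  letI := S.totalTopology
  letI := S'.totalTopology
  Continuous (fun p : TotalSpace ℂ E => (⟨p.1, ψ p.1 p.2⟩ : TotalSpace ℂ E')) ∧
    Continuous (fun p : TotalSpace ℂ E' => (⟨p.1, (ψ p.1).symm p.2⟩ : TotalSpace ℂ E))

/-- The line bundle glued from trivial ones by the transition functions of `Z`. -/
def coreLineBundle {ι : Type*} (Z : VectorBundleCore ℂ B ℂ ι) : LineBundleStructure Z.Fiber where

end Bundles

end DetLine

end

open DetLine

noncomputable section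

set_option linter.unusedSectionVars false

namespace DetLine

universe u

variable {H : Type u} [NormedAddCommGroup H] [InnerProductSpace ℂ H] [CompleteSpace H]

/-! The analytic core is that `det (1 + F)`, for `F` of finite rank, is locally Lipschitz in the
trace norm with constants independent of the rank. The trace norm is handled through products of
Hilbert–Schmidt operators: every `K` factors as `X * Y` with both `hsSq X` and `hsSq Y` at most
`traceNorm K`, and conversely `2 * traceNorm (X * Y) ≤ hsSq X + hsSq Y`. This yields the triangle
inequality, the ideal property and the density of finite rank operators. A dimension-free bound on
determinants (`norm_det_one_add_sq_le`) and the Schwarz lemma along complex lines then give the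
Lipschitz estimate `dist_finiteRankDet_le`. Hence the Fredholm determinant is a genuine limit; it
inherits multiplicativity, which is the cocycle identity for `g_{A,B}`, and the cocycle is locally a
uniform limit of holomorphic functions.

By the cocycle identity, evaluation at one `A` identifies `𝓓_T` with `ℂ`. The defining relation of
`𝓓_T` collapses `φ_T(f)` to `f(L ∘ π_T)` times the Quillen vector, so `A` disappears. Passing from
`L` to `L'` multiplies `f(L ∘ π_T)` by `det ((ρ L')⁻¹ (ρ L))` (`cocycle_extendByZero`), while the
Quillen vector of `L` is that same determinant times the one of `L'` (`quillenVector_eq_smul`); the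
product is unchanged. The basis of the kernel enters once through its dual and once directly, with
inverse determinants.

The bundle structures on both families are transported from the bundle glued by the cocycle, so the
stated trivializations and isomorphisms are compatible by construction. -/

/-! ### Hilbert–Schmidt operators -/

/-- The square of the Hilbert–Schmidt norm. -/
def hsSq (X : H →L[ℂ] H) : ℝ≥0∞ :=
  ∑' i, ‖X (hilbertBasis H i)‖ₑ ^ 2

theorem tsum_enorm_inner_sq_le {ι : Type*} {e : ι → H} (he : Orthonormal ℂ e) (x : H) :
    ∑' j, ‖⟪e j, x⟫_ℂ‖ₑ ^ 2 ≤ ‖x‖ₑ ^ 2 := by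
  rw [ENNReal.tsum_eq_iSup_sum]
  refine iSup_le fun s => ?_
  have h := he.sum_inner_products_le x (s := s)
  have h' := ENNReal.ofReal_le_ofReal h
  rw [ENNReal.ofReal_sum_of_nonneg (fun _ _ => by positivity)] at h'
  simpa only [ENNReal.ofReal_pow (norm_nonneg _), ofReal_norm] using h'

theorem tsum_enorm_inner_hilbertBasis_sq (x : H) :
    ∑' i, ‖⟪hilbertBasis H i, x⟫_ℂ‖ₑ ^ 2 = ‖x‖ₑ ^ 2 := by
  have h := (hilbertBasis H).hasSum_inner_mul_inner x x
  have h2 : HasSum (fun i => ‖⟪hilbertBasis H i, x⟫_ℂ‖ ^ 2) (‖x‖ ^ 2) := by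
    have h3 := (Complex.hasSum_re h)
    have : (⟪x, x⟫_ℂ).re = ‖x‖ ^ 2 := inner_self_eq_norm_sq (𝕜 := ℂ) x
    rw [this] at h3
    refine h3.congr_fun fun i => ?_
    rw [← inner_conj_symm x, ← Complex.normSq_eq_conj_mul_self, Complex.ofReal_re,
      Complex.normSq_eq_norm_sq]
  have h4 := ENNReal.ofReal_tsum_of_nonneg (fun i => by positivity) h2.summable
  rw [h2.tsum_eq] at h4
  simpa only [ENNReal.ofReal_pow (norm_nonneg _), ofReal_norm] using h4.symm

/-- Parseval in the fixed basis, an exchange of two sums of nonnegative terms, then Bessel for `e`.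
Taking `e` to be the fixed basis gives invariance of `hsSq` under adjoints. -/
theorem tsum_enorm_apply_sq_le_hsSq_adjoint {ι : Type*} {e : ι → H} (he : Orthonormal ℂ e)
    (X : H →L[ℂ] H) : ∑' j, ‖X (e j)‖ₑ ^ 2 ≤ hsSq (star X) := by
  calc ∑' j, ‖X (e j)‖ₑ ^ 2
      = ∑' j, ∑' i, ‖⟪e j, star X (hilbertBasis H i)⟫_ℂ‖ₑ ^ 2 := by
        refine tsum_congr fun j => ?_
        rw [← tsum_enorm_inner_hilbertBasis_sq]
        refine tsum_congr fun i => ?_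
        rw [ContinuousLinearMap.star_eq_adjoint, ContinuousLinearMap.adjoint_inner_right,
          ← inner_conj_symm, RCLike.enorm_conj]
    _ = ∑' i, ∑' j, ‖⟪e j, star X (hilbertBasis H i)⟫_ℂ‖ₑ ^ 2 := ENNReal.tsum_comm
    _ ≤ hsSq (star X) := ENNReal.tsum_le_tsum fun i => tsum_enorm_inner_sq_le he _

theorem hsSq_star (X : H →L[ℂ] H) : hsSq (star X) = hsSq X := by
  refine le_antisymm ?_ ?_
  · have h := tsum_enorm_apply_sq_le_hsSq_adjoint (hilbertBasis H).orthonormal (star X)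
    rwa [star_star] at h
  · exact tsum_enorm_apply_sq_le_hsSq_adjoint (hilbertBasis H).orthonormal X

theorem tsum_enorm_apply_sq_le_hsSq {ι : Type*} {e : ι → H} (he : Orthonormal ℂ e)
    (X : H →L[ℂ] H) : ∑' j, ‖X (e j)‖ₑ ^ 2 ≤ hsSq X :=
  (tsum_enorm_apply_sq_le_hsSq_adjoint he X).trans_eq (hsSq_star X)

theorem hsSq_mul_le_left (A X : H →L[ℂ] H) : hsSq (A * X) ≤ ‖A‖ₑ ^ 2 * hsSq X := by
  rw [hsSq, hsSq, ← ENNReal.tsum_mul_left]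
  refine ENNReal.tsum_le_tsum fun i => ?_
  rw [← mul_pow]
  gcongr
  exact A.le_opENorm _

theorem hsSq_mul_le_right (X A : H →L[ℂ] H) : hsSq (X * A) ≤ ‖A‖ₑ ^ 2 * hsSq X := by
  rw [← hsSq_star, star_mul, ← hsSq_star X]
  refine (hsSq_mul_le_left _ _).trans_eq ?_
  rw [← ofReal_norm, ← ofReal_norm, norm_star]

theorem enorm_apply_sq_le_hsSq (X : H →L[ℂ] H) (x : H) : ‖X x‖ₑ ^ 2 ≤ hsSq X * ‖x‖ₑ ^ 2 := by
  have key : ‖star (star X) x‖ₑ ^ 2 ≤ hsSq X * ‖x‖ₑ ^ 2 := by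
    rw [← tsum_enorm_inner_hilbertBasis_sq, ← hsSq_star, hsSq, ← ENNReal.tsum_mul_right]
    refine ENNReal.tsum_le_tsum fun i => ?_
    rw [← mul_pow, ContinuousLinearMap.star_eq_adjoint (star X),
      ContinuousLinearMap.adjoint_inner_right]
    gcongr
    rw [← ofReal_norm, ← ofReal_norm, ← ofReal_norm, ← ENNReal.ofReal_mul (norm_nonneg _)]
    exact ENNReal.ofReal_le_ofReal (norm_inner_le_norm _ _)
  simpa using key

/-- The additive form `2ab ≤ a² + b²` replaces Cauchy–Schwarz for sums and avoids square roots in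
`ℝ≥0∞`. Nothing is lost when both factors have `hsSq` at most the trace norm of the product. -/
theorem two_mul_tsum_enorm_inner_le {ι : Type*} {e : ι → H} (he : Orthonormal ℂ e)
    (X Y : H →L[ℂ] H) : 2 * ∑' j, ‖⟪e j, (X * Y) (e j)⟫_ℂ‖ₑ ≤ hsSq X + hsSq Y := by
  calc 2 * ∑' j, ‖⟪e j, (X * Y) (e j)⟫_ℂ‖ₑ
      = ∑' j, 2 * ‖⟪e j, (X * Y) (e j)⟫_ℂ‖ₑ := ENNReal.tsum_mul_left.symm
    _ ≤ ∑' j, (‖star X (e j)‖ₑ ^ 2 + ‖Y (e j)‖ₑ ^ 2) := by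
        refine ENNReal.tsum_le_tsum fun j => ?_
        have h1 : ⟪e j, (X * Y) (e j)⟫_ℂ = ⟪star X (e j), Y (e j)⟫_ℂ := by
          rw [ContinuousLinearMap.star_eq_adjoint, ContinuousLinearMap.adjoint_inner_left]
          rfl
        have h2 : 2 * ‖⟪e j, (X * Y) (e j)⟫_ℂ‖ ≤ ‖star X (e j)‖ ^ 2 + ‖Y (e j)‖ ^ 2 := by
          rw [h1]
          nlinarith [norm_inner_le_norm (𝕜 := ℂ) (star X (e j)) (Y (e j)),
            sq_nonneg (‖star X (e j)‖ - ‖Y (e j)‖)]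
        have h3 := ENNReal.ofReal_le_ofReal h2
        rwa [ENNReal.ofReal_mul two_pos.le, ENNReal.ofReal_add (by positivity) (by positivity),
          ENNReal.ofReal_pow (norm_nonneg _), ENNReal.ofReal_pow (norm_nonneg _), ofReal_norm,
          ofReal_norm, ofReal_norm, ENNReal.ofReal_ofNat] at h3
    _ ≤ hsSq X + hsSq Y := by
        rw [ENNReal.tsum_add]
        refine add_le_add ?_ (tsum_enorm_apply_sq_le_hsSq he Y)
        exact (tsum_enorm_apply_sq_le_hsSq he _).trans_eq (hsSq_star X)

/-! ### Polar decomposition -/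

/-- Douglas' factorization lemma, for contractions. -/
theorem exists_contraction_mul_eq {A B : H →L[ℂ] H} (h : ∀ x, ‖A x‖ ≤ ‖B x‖) :
    ∃ V : H →L[ℂ] H, ‖V‖ ≤ 1 ∧ A = V * B := by
  have hker : B.ker ≤ A.ker := fun x hx => by
    have h1 : B x = 0 := hx
    have := h x
    rw [h1, norm_zero] at this
    exact norm_le_zero_iff.1 this
  -- The map `B x ↦ A x` is well defined and contractive on the range of `B`; it extends by
  -- continuity to the closure and by zero to the orthogonal complement.
  let f₀ : B.range →ₗ[ℂ] H :=
    (B.ker.liftQ (A : H →ₗ[ℂ] H) hker) ∘ₗ (B : H →ₗ[ℂ] H).quotKerEquivRange.symm.toLinearMap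
  have hf₀ : ∀ x, f₀ ⟨B x, x, rfl⟩ = A x := fun x => by
    have : (B : H →ₗ[ℂ] H).quotKerEquivRange.symm ⟨B x, x, rfl⟩ = B.ker.mkQ x :=
      LinearMap.quotKerEquivRange_symm_apply_image (B : H →ₗ[ℂ] H) x _
    simp only [f₀, LinearMap.comp_apply, LinearEquiv.coe_coe, this]
    exact Submodule.liftQ_apply _ _ _
  have hb : ∀ y : B.range, ‖f₀ y‖ ≤ 1 * ‖y‖ := by
    rintro ⟨_, x, rfl⟩
    rw [one_mul]
    exact (congrArg norm (hf₀ x)).le.trans (h x)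
  let f : B.range →L[ℂ] H := f₀.mkContinuous 1 hb
  let W := B.range.topologicalClosure
  let ι : B.range →ₗᵢ[ℂ] W :=
    ⟨Submodule.inclusion B.range.le_topologicalClosure, fun x => rfl⟩
  have hd : DenseRange ι := by
    intro y
    have : (y : H) ∈ closure (B.range : Set H) := y.2
    rw [Metric.mem_closure_iff] at this ⊢
    intro ε hε
    obtain ⟨b, hb, hyb⟩ := this ε hε
    exact ⟨ι ⟨b, hb⟩, ⟨_, rfl⟩, hyb⟩
  let g : W →L[ℂ] H := f.extend ι.toContinuousLinearMap
  have hg : ∀ y : B.range, g (ι y) = f y := fun y =>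
    ContinuousLinearMap.extend_eq f (e := ι.toContinuousLinearMap) hd
      ι.isometry.isUniformInducing y
  have hgn : ‖g‖ ≤ 1 := by
    have := ContinuousLinearMap.opNorm_extend_le f (e := ι.toContinuousLinearMap) (N := 1) hd
      (fun x => by simp)
    refine this.trans ?_
    simpa using f₀.mkContinuous_norm_le zero_le_one hb
  have : CompleteSpace W := B.range.isClosed_topologicalClosure.completeSpace_coe
  refine ⟨g ∘L W.orthogonalProjectionOnto, ?_, ?_⟩
  · refine (ContinuousLinearMap.opNorm_comp_le _ _).trans ?_
    have := W.orthogonalProjectionOnto_norm_le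
    exact mul_le_one₀ hgn (norm_nonneg _) this
  · ext x
    have hx : W.orthogonalProjectionOnto (B x) = ι ⟨B x, x, rfl⟩ :=
      W.orthogonalProjectionOnto_mem_subspace_eq_self (ι ⟨B x, x, rfl⟩)
    change A x = g (W.orthogonalProjectionOnto (B x))
    rw [hx, hg]
    exact (hf₀ x).symm

/-- Since `|K|² = K* K`, both squares equal `⟪K* K x, x⟫`. Equality lets Douglas' lemma run in both
directions, which is all that is needed of the polar decomposition. -/
theorem norm_abs_apply (K : H →L[ℂ] H) (x : H) : ‖CFC.abs K x‖ = ‖K x‖ := by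
  have hsa : star (CFC.abs K) = CFC.abs K := (CFC.abs_nonneg K).isSelfAdjoint.star_eq
  have h1 : ∀ A : H →L[ℂ] H, ⟪(star A * A) x, x⟫_ℂ = (‖A x‖ : ℂ) ^ 2 := fun A => by
    have : (star A * A) x = star A (A x) := rfl
    rw [this, ContinuousLinearMap.star_eq_adjoint, ContinuousLinearMap.adjoint_inner_left,
      inner_self_eq_norm_sq_to_K]
    rfl
  have h2 : ((‖CFC.abs K x‖ : ℂ)) ^ 2 = (‖K x‖ : ℂ) ^ 2 := by
    rw [← h1, ← h1, hsa, CFC.abs_mul_abs]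
  have h3 : ‖CFC.abs K x‖ ^ 2 = ‖K x‖ ^ 2 := by exact_mod_cast h2
  exact (sq_eq_sq₀ (norm_nonneg _) (norm_nonneg _)).1 h3

theorem exists_eq_contraction_mul_abs (K : H →L[ℂ] H) :
    ∃ U : H →L[ℂ] H, ‖U‖ ≤ 1 ∧ K = U * CFC.abs K :=
  exists_contraction_mul_eq fun x => (norm_abs_apply K x).ge

theorem exists_abs_eq_contraction_mul (K : H →L[ℂ] H) :
    ∃ V : H →L[ℂ] H, ‖V‖ ≤ 1 ∧ CFC.abs K = V * K :=
  exists_contraction_mul_eq fun x => (norm_abs_apply K x).le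

theorem enorm_le_one_of_norm_le_one {A : H →L[ℂ] H} (h : ‖A‖ ≤ 1) : ‖A‖ₑ ≤ 1 := by
  rw [← ofReal_norm, ← ENNReal.ofReal_one]
  exact ENNReal.ofReal_le_ofReal h

theorem hsSq_contraction_mul_le {A : H →L[ℂ] H} (h : ‖A‖ ≤ 1) (X : H →L[ℂ] H) :
    hsSq (A * X) ≤ hsSq X := by
  refine (hsSq_mul_le_left A X).trans ?_
  have := pow_le_one₀ (n := 2) zero_le (enorm_le_one_of_norm_le_one h)
  exact (mul_le_mul_left this _).trans_eq (one_mul _)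

theorem hsSq_mul_contraction_le {A : H →L[ℂ] H} (h : ‖A‖ ≤ 1) (X : H →L[ℂ] H) :
    hsSq (X * A) ≤ hsSq X := by
  refine (hsSq_mul_le_right X A).trans ?_
  have := pow_le_one₀ (n := 2) zero_le (enorm_le_one_of_norm_le_one h)
  exact (mul_le_mul_left this _).trans_eq (one_mul _)

/-! ### The trace norm -/

theorem traceNorm_eq_hsSq_sqrt_abs (K : H →L[ℂ] H) :
    traceNorm K = hsSq (CFC.sqrt (CFC.abs K)) := by
  set P := CFC.sqrt (CFC.abs K) with hP
  have hsa : star P = P := (CFC.sqrt_nonneg _).isSelfAdjoint.star_eq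
  have hPP : P * P = CFC.abs K := CFC.sqrt_mul_sqrt_self _ (CFC.abs_nonneg K)
  refine tsum_congr fun i => ?_
  rw [← hPP, ← ofReal_norm, ← ENNReal.ofReal_pow (norm_nonneg _)]
  congr 1
  have : (P * P) (hilbertBasis H i) = P (P (hilbertBasis H i)) := rfl
  rw [this]
  conv_lhs => rw [← hsa]
  rw [ContinuousLinearMap.star_eq_adjoint, ContinuousLinearMap.adjoint_inner_right,
    ← ContinuousLinearMap.star_eq_adjoint, hsa]
  exact inner_self_eq_norm_sq _

/-- With `K = U |K|`, split `|K|` into two square roots: `X = U |K|^{1/2}`, `Y = |K|^{1/2}`. -/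
theorem exists_hsSq_factorization (K : H →L[ℂ] H) :
    ∃ X Y : H →L[ℂ] H, K = X * Y ∧ hsSq X ≤ traceNorm K ∧ hsSq Y ≤ traceNorm K := by
  obtain ⟨U, hU, hK⟩ := exists_eq_contraction_mul_abs K
  refine ⟨U * CFC.sqrt (CFC.abs K), CFC.sqrt (CFC.abs K), ?_, ?_, ?_⟩
  · rw [mul_assoc, CFC.sqrt_mul_sqrt_self _ (CFC.abs_nonneg K), ← hK]
  · exact (hsSq_contraction_mul_le hU _).trans_eq (traceNorm_eq_hsSq_sqrt_abs K).symm
  · exact (traceNorm_eq_hsSq_sqrt_abs K).ge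

/-- Half of a duality: by `traceNorm_le_tsum` the bound is attained in the fixed basis when `V * K =
|K|`. Subadditivity of the trace norm follows by applying this to one `V` and two operators. -/
theorem tsum_enorm_inner_le_traceNorm {ι : Type*} {e : ι → H} (he : Orthonormal ℂ e)
    {V : H →L[ℂ] H} (hV : ‖V‖ ≤ 1) (K : H →L[ℂ] H) :
    ∑' j, ‖⟪e j, (V * K) (e j)⟫_ℂ‖ₑ ≤ traceNorm K := by
  obtain ⟨X, Y, hK, hX, hY⟩ := exists_hsSq_factorization K
  have h := two_mul_tsum_enorm_inner_le he (V * X) Y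
  rw [mul_assoc, ← hK] at h
  have h2 := h.trans (add_le_add ((hsSq_contraction_mul_le hV X).trans hX) hY)
  rw [← two_mul] at h2
  exact (ENNReal.mul_le_mul_iff_right two_ne_zero ENNReal.ofNat_ne_top).1 h2

theorem traceNorm_le_tsum {V K : H →L[ℂ] H} (h : CFC.abs K = V * K) :
    traceNorm K ≤ ∑' i, ‖⟪hilbertBasis H i, (V * K) (hilbertBasis H i)⟫_ℂ‖ₑ := by
  refine ENNReal.tsum_le_tsum fun i => ?_
  rw [← h, ← ofReal_norm]
  exact ENNReal.ofReal_le_ofReal (RCLike.re_le_norm _)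

theorem two_mul_traceNorm_mul_le (X Y : H →L[ℂ] H) :
    2 * traceNorm (X * Y) ≤ hsSq X + hsSq Y := by
  obtain ⟨V, hV, h⟩ := exists_abs_eq_contraction_mul (X * Y)
  calc 2 * traceNorm (X * Y)
      ≤ 2 * ∑' i, ‖⟪hilbertBasis H i, (V * (X * Y)) (hilbertBasis H i)⟫_ℂ‖ₑ := by
        gcongr
        exact traceNorm_le_tsum h
    _ ≤ hsSq (V * X) + hsSq Y := by
        rw [← mul_assoc]
        exact two_mul_tsum_enorm_inner_le (hilbertBasis H).orthonormal _ _
    _ ≤ hsSq X + hsSq Y := by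
        gcongr
        exact hsSq_contraction_mul_le hV X

theorem traceNorm_add_le (A B : H →L[ℂ] H) : traceNorm (A + B) ≤ traceNorm A + traceNorm B := by
  obtain ⟨V, hV, h⟩ := exists_abs_eq_contraction_mul (A + B)
  have ho := (hilbertBasis H).orthonormal
  refine (traceNorm_le_tsum h).trans ((?_ : _ ≤ _).trans (add_le_add
    (tsum_enorm_inner_le_traceNorm ho hV A) (tsum_enorm_inner_le_traceNorm ho hV B)))
  rw [← ENNReal.tsum_add]
  refine ENNReal.tsum_le_tsum fun i => ?_
  rw [mul_add, add_apply, inner_add_right]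
  exact enorm_add_le _ _

theorem traceNorm_smul (c : ℂ) (K : H →L[ℂ] H) : traceNorm (c • K) = ‖c‖ₑ * traceNorm K := by
  rw [traceNorm, traceNorm, ← ENNReal.tsum_mul_left]
  refine tsum_congr fun i => ?_
  rw [CFC.abs_smul, smul_apply, inner_smul_right_eq_smul,
    ← ofReal_norm, ← ENNReal.ofReal_mul (norm_nonneg _)]
  congr 1
  simp

theorem traceNorm_neg (K : H →L[ℂ] H) : traceNorm (-K) = traceNorm K := by
  rw [traceNorm, traceNorm, CFC.abs_neg]

theorem traceNorm_sub_le (A B : H →L[ℂ] H) : traceNorm (A - B) ≤ traceNorm A + traceNorm B := by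
  rw [sub_eq_add_neg]
  exact (traceNorm_add_le _ _).trans_eq (by rw [traceNorm_neg])

@[simp]
theorem traceNorm_zero : traceNorm (0 : H →L[ℂ] H) = 0 := by
  simp [traceNorm]

theorem traceNorm_mul_le_left (A K : H →L[ℂ] H) : traceNorm (A * K) ≤ ‖A‖ₑ * traceNorm K := by
  have key : ∀ V : H →L[ℂ] H, ‖V‖ ≤ 1 → traceNorm (V * K) ≤ traceNorm K := fun V hV => by
    obtain ⟨X, Y, hK, hX, hY⟩ := exists_hsSq_factorization K
    have h := two_mul_traceNorm_mul_le (V * X) Y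
    rw [mul_assoc, ← hK] at h
    have h2 := h.trans (add_le_add ((hsSq_contraction_mul_le hV X).trans hX) hY)
    rw [← two_mul] at h2
    exact (ENNReal.mul_le_mul_iff_right two_ne_zero ENNReal.ofNat_ne_top).1 h2
  rcases eq_or_ne A 0 with rfl | hA
  · simp
  have hA' : (‖A‖ : ℂ) ≠ 0 := by simpa using hA
  have h := key ((‖A‖ : ℂ)⁻¹ • A) (by simp [norm_smul, hA])
  have h2 : A * K = (‖A‖ : ℂ) • (((‖A‖ : ℂ)⁻¹ • A) * K) := by
    rw [← smul_mul_assoc, smul_inv_smul₀ hA']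
  rw [h2, traceNorm_smul]
  refine (mul_le_mul_right h _).trans_eq ?_
  congr 1
  simp [← ofReal_norm]

theorem traceNorm_mul_le_right (K A : H →L[ℂ] H) : traceNorm (K * A) ≤ ‖A‖ₑ * traceNorm K := by
  have key : ∀ V : H →L[ℂ] H, ‖V‖ ≤ 1 → traceNorm (K * V) ≤ traceNorm K := fun V hV => by
    obtain ⟨X, Y, hK, hX, hY⟩ := exists_hsSq_factorization K
    have h := two_mul_traceNorm_mul_le X (Y * V)
    rw [← mul_assoc, ← hK] at h
    have h2 := h.trans (add_le_add hX ((hsSq_mul_contraction_le hV Y).trans hY))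
    rw [← two_mul] at h2
    exact (ENNReal.mul_le_mul_iff_right two_ne_zero ENNReal.ofNat_ne_top).1 h2
  rcases eq_or_ne A 0 with rfl | hA
  · simp
  have hA' : (‖A‖ : ℂ) ≠ 0 := by simpa using hA
  have h := key ((‖A‖ : ℂ)⁻¹ • A) (by simp [norm_smul, hA])
  have h2 : K * A = (‖A‖ : ℂ) • (K * ((‖A‖ : ℂ)⁻¹ • A)) := by
    rw [← mul_smul_comm, smul_inv_smul₀ hA']
  rw [h2, traceNorm_smul]
  refine (mul_le_mul_right h _).trans_eq ?_
  congr 1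
  simp [← ofReal_norm]

theorem enorm_le_traceNorm (K : H →L[ℂ] H) : ‖K‖ₑ ≤ traceNorm K := by
  obtain ⟨X, Y, hK, hX, hY⟩ := exists_hsSq_factorization K
  rcases eq_or_ne (traceNorm K) ∞ with ht | ht
  · rw [ht]; exact le_top
  rw [← ofReal_norm, ENNReal.ofReal_le_iff_le_toReal ht]
  refine K.opNorm_le_bound ENNReal.toReal_nonneg fun x => ?_
  have h1 : ‖K x‖ₑ ^ 2 ≤ (traceNorm K * ‖x‖ₑ) ^ 2 := by
    have hx : K x = X (Y x) := by rw [hK]; rfl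
    rw [hx, mul_pow, pow_two (traceNorm K), mul_assoc]
    refine (enorm_apply_sq_le_hsSq X _).trans ?_
    exact mul_le_mul' hX ((enorm_apply_sq_le_hsSq Y x).trans (mul_le_mul' hY le_rfl))
  have h2 : ‖K x‖ₑ ≤ traceNorm K * ‖x‖ₑ := (ENNReal.pow_le_pow_left_iff two_ne_zero).1 h1
  rw [← ofReal_norm, ← ofReal_norm, ← ENNReal.ofReal_toReal ht,
    ← ENNReal.ofReal_mul ENNReal.toReal_nonneg] at h2
  rwa [ENNReal.ofReal_le_ofReal_iff (by positivity)] at h2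

/-! ### Finite rank operators -/

theorem hsSq_starProjection (W : Submodule ℂ H) [FiniteDimensional ℂ W] :
    hsSq W.starProjection ≤ Module.finrank ℂ W := by
  let e := stdOrthonormalBasis ℂ W
  have h1 : ∀ x : H, ‖W.starProjection x‖ₑ ^ 2 = ∑ j, ‖⟪x, (e j : H)⟫_ℂ‖ₑ ^ 2 := fun x => by
    have h2 := e.sum_sq_norm_inner_right (W.orthogonalProjectionOnto x)
    have h3 : ∀ j, ‖⟪e j, W.orthogonalProjectionOnto x⟫_ℂ‖ = ‖⟪x, (e j : H)⟫_ℂ‖ := fun j => by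
      rw [Submodule.coe_inner, Submodule.coe_orthogonalProjectionOnto_apply,
        ← Submodule.inner_starProjection_left_eq_right, norm_inner_symm,
        Submodule.starProjection_eq_self_iff.2 (e j).2]
    simp only [h3] at h2
    have h4 : ‖W.orthogonalProjectionOnto x‖ = ‖W.starProjection x‖ := rfl
    rw [h4] at h2
    simp only [← ofReal_norm, ← ENNReal.ofReal_pow (norm_nonneg _)]
    rw [← h2, ENNReal.ofReal_sum_of_nonneg fun _ _ => by positivity]
  calc hsSq W.starProjection
      = ∑' i, ∑ j, ‖⟪hilbertBasis H i, (e j : H)⟫_ℂ‖ₑ ^ 2 := tsum_congr fun i => h1 _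
    _ = ∑ j, ∑' i, ‖⟪hilbertBasis H i, (e j : H)⟫_ℂ‖ₑ ^ 2 :=
        Summable.tsum_finsetSum fun _ _ => ENNReal.summable
    _ = ∑ j, (1 : ℝ≥0∞) := by
        refine Finset.sum_congr rfl fun j _ => ?_
        rw [tsum_enorm_inner_hilbertBasis_sq, ← ofReal_norm]
        have : ‖(e j : H)‖ = 1 := e.orthonormal.1 j
        simp [this]
    _ ≤ Module.finrank ℂ W := by simp

theorem isTraceClass_of_finiteDimensional_range (F : H →L[ℂ] H) [FiniteDimensional ℂ F.range] :
    IsTraceClass F := by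
  have hQ : F.range.starProjection * F = F := by
    ext x
    exact Submodule.starProjection_eq_self_iff.2 ⟨x, rfl⟩
  have h0 : hsSq F.range.starProjection < ∞ :=
    (hsSq_starProjection F.range).trans_lt (ENNReal.natCast_lt_top _)
  have h1 : hsSq F < ∞ := by
    rw [← hQ]
    refine (hsSq_mul_le_right _ _).trans_lt (ENNReal.mul_lt_top ?_ h0)
    exact ENNReal.pow_lt_top enorm_lt_top
  have h2 := two_mul_traceNorm_mul_le F.range.starProjection F
  rw [hQ] at h2
  have h3 := h2.trans_lt (ENNReal.add_lt_top.2 ⟨h0, h1⟩)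
  exact lt_of_le_of_lt (by rw [two_mul]; exact le_self_add) h3

theorem exists_finiteRank_hsSq_sub_lt {Y : H →L[ℂ] H} (hY : hsSq Y ≠ ∞) {ε : ℝ≥0∞} (hε : ε ≠ 0) :
    ∃ Q : H →L[ℂ] H, FiniteDimensional ℂ Q.range ∧ hsSq (Y * (1 - Q)) < ε := by
  classical
  let f : basisIndex H → ℝ≥0∞ := fun i => ‖Y (hilbertBasis H i)‖ₑ ^ 2
  have ht : Tendsto (fun s : Finset (basisIndex H) => ∑' b : { x // x ∉ s }, f b) atTop (𝓝 0) :=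
    ENNReal.tendsto_tsum_compl_atTop_zero hY
  obtain ⟨s, hs⟩ := (ht.eventually_lt_const (pos_iff_ne_zero.2 hε)).exists
  let W : Submodule ℂ H := Submodule.span ℂ ((hilbertBasis H) '' s)
  have : FiniteDimensional ℂ W := FiniteDimensional.span_of_finite ℂ (s.finite_toSet.image _)
  refine ⟨W.starProjection, ?_, ?_⟩
  · rw [Submodule.range_starProjection]
    exact this
  · refine lt_of_le_of_lt (le_of_eq ?_) hs
    have h1 : ∀ i, ‖(Y * (1 - W.starProjection)) (hilbertBasis H i)‖ₑ ^ 2 =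
        Set.indicator {i | i ∉ s} f i := fun i => by
      by_cases hi : i ∈ s
      · have : W.starProjection (hilbertBasis H i) = hilbertBasis H i :=
          Submodule.starProjection_eq_self_iff.2 (Submodule.subset_span ⟨i, hi, rfl⟩)
        simp [hi, this]
      · have : W.starProjection (hilbertBasis H i) = 0 := by
          rw [Submodule.starProjection_apply_eq_zero_iff, Submodule.mem_orthogonal]
          intro u hu
          induction hu using Submodule.span_induction with
          | mem x hx =>
            obtain ⟨j, hj, rfl⟩ := hx
            exact (hilbertBasis H).orthonormal.2 fun h => hi (h ▸ hj)
          | zero => simp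
          | add x y _ _ hx hy => rw [inner_add_left, hx, hy, add_zero]
          | smul a x _ hx => rw [inner_smul_left, hx, mul_zero]
        simp [hi, this, f]
    rw [hsSq, tsum_congr h1]
    exact (tsum_subtype {i | i ∉ s} f).symm

theorem hsSq_smul (c : ℂ) (X : H →L[ℂ] H) : hsSq (c • X) = ‖c‖ₑ ^ 2 * hsSq X := by
  rw [hsSq, hsSq, ← ENNReal.tsum_mul_left]
  refine tsum_congr fun i => ?_
  rw [smul_apply, enorm_smul, mul_pow]

theorem exists_finiteRank_traceNorm_sub_lt {K : H →L[ℂ] H} (hK : IsTraceClass K) {ε : ℝ≥0∞}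
    (hε : ε ≠ 0) : ∃ F : H →L[ℂ] H, FiniteDimensional ℂ F.range ∧ traceNorm (K - F) < ε := by
  obtain ⟨X, Y, hXY, hX, hY⟩ := exists_hsSq_factorization K
  have hX' : hsSq X ≠ ∞ := (hX.trans_lt hK).ne
  have hY' : hsSq Y ≠ ∞ := (hY.trans_lt hK).ne
  -- The scalar rebalances the factors of `K - K * Q = X * (Y * (1 - Q))`: first `c` makes `c • X`
  -- small, then `Q` makes `c⁻¹ • (Y * (1 - Q))` small.
  obtain ⟨c, hc0, hc⟩ : ∃ c : ℂ, c ≠ 0 ∧ ‖c‖ₑ ^ 2 * hsSq X < ε := by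
    have h1 : Tendsto (fun c : ℂ => ‖c‖ₑ ^ 2 * hsSq X) (𝓝[≠] 0) (𝓝 (‖(0 : ℂ)‖ₑ ^ 2 * hsSq X)) := by
      refine Tendsto.mono_left ?_ nhdsWithin_le_nhds
      refine ENNReal.Tendsto.mul_const ?_ (Or.inr hX')
      exact ENNReal.Tendsto.pow (continuous_enorm.tendsto (0 : ℂ))
    have h2 : ‖(0 : ℂ)‖ₑ ^ 2 * hsSq X < ε := by simpa using pos_iff_ne_zero.2 hε
    obtain ⟨c, hc, hc'⟩ := ((h1.eventually_lt_const h2).and self_mem_nhdsWithin).exists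
    exact ⟨c, hc', hc⟩
  have hcε : ‖c‖ₑ ^ 2 * ε ≠ 0 := mul_ne_zero (by simpa using hc0) hε
  obtain ⟨Q, hQ, hQε⟩ := exists_finiteRank_hsSq_sub_lt hY' hcε
  refine ⟨K * Q, ?_, ?_⟩
  · have : (K * Q).range = Q.range.map (K : H →ₗ[ℂ] H) := LinearMap.range_comp _ _
    rw [this]
    infer_instance
  · have h1 : K - K * Q = (c • X) * (c⁻¹ • (Y * (1 - Q))) := by
      rw [smul_mul_smul_comm, mul_inv_cancel₀ hc0, one_smul, ← mul_assoc, ← hXY, mul_sub, mul_one]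
    have h2 := two_mul_traceNorm_mul_le (c • X) (c⁻¹ • (Y * (1 - Q)))
    rw [← h1, hsSq_smul, hsSq_smul] at h2
    have h3 : ‖c⁻¹‖ₑ ^ 2 * hsSq (Y * (1 - Q)) < ε := by
      have hc1 : ‖c‖ₑ ^ 2 ≠ 0 := by simpa using hc0
      have hc2 : ‖c‖ₑ ^ 2 ≠ ∞ := ENNReal.pow_ne_top enorm_ne_top
      rw [enorm_inv hc0, ← ENNReal.inv_pow, mul_comm, ← div_eq_mul_inv]
      rw [ENNReal.div_lt_iff (Or.inl hc1) (Or.inl hc2), mul_comm]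
      exact hQε
    have h4 := h2.trans_lt (ENNReal.add_lt_add hc h3)
    rw [← two_mul] at h4
    exact (ENNReal.mul_lt_mul_iff_right two_ne_zero ENNReal.ofNat_ne_top).1 h4

/-! ### Determinants of finite rank perturbations of the identity -/

section LinearAlgebra

variable {V W : Type*} [AddCommGroup V] [Module ℂ V] [FiniteDimensional ℂ V]
  [AddCommGroup W] [Module ℂ W] [FiniteDimensional ℂ W]

/-- Sylvester's identity. It makes `finiteRankDet` computable on any finite-dimensional space
through which the operator factors. -/
theorem det_id_add_comp_comm (f : V →ₗ[ℂ] W) (g : W →ₗ[ℂ] V) :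
    LinearMap.det (LinearMap.id + f ∘ₗ g) = LinearMap.det (LinearMap.id + g ∘ₗ f) := by
  let b := Module.finBasis ℂ V
  let c := Module.finBasis ℂ W
  rw [← LinearMap.det_toMatrix c, ← LinearMap.det_toMatrix b, map_add, map_add,
    LinearMap.toMatrix_comp c b c, LinearMap.toMatrix_comp b c b, LinearMap.toMatrix_id,
    LinearMap.toMatrix_id, Matrix.det_one_add_mul_comm]

end LinearAlgebra

/-- Enlarging the range lets several operators be compared on one common space. -/
theorem finiteRankDet_eq_det_of_range_le {F : H →L[ℂ] H} {W : Submodule ℂ H}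
    [FiniteDimensional ℂ W] (h : ∀ x, F x ∈ W) :
    finiteRankDet F =
      LinearMap.det (LinearMap.id + ((F : H →ₗ[ℂ] H).codRestrict W h) ∘ₗ W.subtype) := by
  have hle : F.range ≤ W := by
    rintro _ ⟨x, rfl⟩
    exact h x
  have : FiniteDimensional ℂ F.range := Submodule.finiteDimensional_of_le hle
  exact (det_id_add_comp_comm (Submodule.inclusion hle)
    ((F : H →ₗ[ℂ] H).rangeRestrict ∘ₗ W.subtype)).symm

theorem finiteRankDet_comp {V : Type*} [AddCommGroup V] [Module ℂ V] [FiniteDimensional ℂ V]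
    {F : H →L[ℂ] H} (f : V →ₗ[ℂ] H) (g : H →ₗ[ℂ] V) (h : ∀ x, F x = f (g x)) :
    finiteRankDet F = LinearMap.det (LinearMap.id + g ∘ₗ f) := by
  have hF : ∀ x, F x ∈ LinearMap.range f := fun x => ⟨g x, (h x).symm⟩
  rw [finiteRankDet_eq_det_of_range_le hF]
  have h1 := det_id_add_comp_comm f.rangeRestrict (g ∘ₗ (LinearMap.range f).subtype)
  have h2 : (F : H →ₗ[ℂ] H).codRestrict _ hF ∘ₗ (LinearMap.range f).subtype =
      f.rangeRestrict ∘ₗ g ∘ₗ (LinearMap.range f).subtype := by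
    ext x
    exact h x
  rw [h2, h1]
  rfl

/-- The matrix of the compression of `F` to `W`, in an orthonormal basis of `W`. -/
def compressionMatrix (W : Submodule ℂ H) [FiniteDimensional ℂ W] (F : H →L[ℂ] H) :
    Matrix (Fin (Module.finrank ℂ W)) (Fin (Module.finrank ℂ W)) ℂ :=
  .of fun i j => ⟪(stdOrthonormalBasis ℂ W i : H), F (stdOrthonormalBasis ℂ W j)⟫_ℂ

theorem finiteRankDet_eq_det_compressionMatrix {F : H →L[ℂ] H} {W : Submodule ℂ H}
    [FiniteDimensional ℂ W] (h : ∀ x, F x ∈ W) :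
    finiteRankDet F = (1 + compressionMatrix W F).det := by
  rw [finiteRankDet_eq_det_of_range_le h,
    ← LinearMap.det_toMatrix (stdOrthonormalBasis ℂ W).toBasis, map_add, LinearMap.toMatrix_id]
  congr 2
  ext i j
  rw [LinearMap.toMatrix_apply]
  simp [compressionMatrix, OrthonormalBasis.repr_apply_apply]

theorem finiteRankDet_one_add_mul {F G : H →L[ℂ] H} [FiniteDimensional ℂ F.range]
    [FiniteDimensional ℂ G.range] :
    finiteRankDet (F + G + F * G) = finiteRankDet F * finiteRankDet G := by
  let W := F.range ⊔ G.range
  have hF : ∀ x, F x ∈ W := fun x => Submodule.mem_sup_left ⟨x, rfl⟩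
  have hG : ∀ x, G x ∈ W := fun x => Submodule.mem_sup_right ⟨x, rfl⟩
  have hFG : ∀ x, (F + G + F * G) x ∈ W := fun x => W.add_mem (W.add_mem (hF x) (hG x)) (hF _)
  rw [finiteRankDet_eq_det_of_range_le hF, finiteRankDet_eq_det_of_range_le hG,
    finiteRankDet_eq_det_of_range_le hFG, ← LinearMap.det_comp]
  congr 1
  ext x
  simp
  abel

-- With `M = 1 + N`, `|det M|²` is the product of the eigenvalues `λ ≥ 0` of `M* M`, each at most
-- `exp (λ - 1)`, and `∑ (λ - 1) = tr (M* M - 1) = 2 Re tr N + tr (N* N)`. The size of the matrix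
-- does not enter.
open scoped ComplexOrder in
theorem norm_det_one_add_sq_le {n : Type*} [Fintype n] [DecidableEq n] (N : Matrix n n ℂ) :
    ‖(1 + N).det‖ ^ 2 ≤ Real.exp (2 * ‖N.trace‖ + ∑ j, ∑ i, ‖N i j‖ ^ 2) := by
  let M := 1 + N
  have hM : (M.conjTranspose * M).PosSemidef := Matrix.posSemidef_conjTranspose_mul_self M
  have hH := hM.isHermitian
  have h1 : ((‖M.det‖ ^ 2 : ℝ) : ℂ) = ((∏ i, hH.eigenvalues i : ℝ) : ℂ) := by
    have h2 := hH.det_eq_prod_eigenvalues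
    rw [Matrix.det_mul, Matrix.det_conjTranspose, RCLike.star_def, RCLike.conj_mul] at h2
    push_cast
    exact h2
  have h1' : ‖M.det‖ ^ 2 = ∏ i, hH.eigenvalues i := Complex.ofReal_injective h1
  have h3 : ((∑ i, (hH.eigenvalues i - 1) : ℝ) : ℂ) =
      N.trace + star N.trace + (N.conjTranspose * N).trace := by
    have h4 := hH.trace_eq_sum_eigenvalues
    have h5 : M.conjTranspose * M = 1 + N + N.conjTranspose + N.conjTranspose * N := by
      simp only [M, Matrix.conjTranspose_add, Matrix.conjTranspose_one]
      noncomm_ring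
    have h6 := congrArg Matrix.trace h5
    rw [h4, Matrix.trace_add, Matrix.trace_add, Matrix.trace_add, Matrix.trace_one,
      Matrix.trace_conjTranspose] at h6
    rw [Finset.sum_sub_distrib]
    push_cast
    have h6 : ∑ i, ((hH.eigenvalues i : ℝ) : ℂ) =
      (Fintype.card n : ℂ) + N.trace + star N.trace + (N.conjTranspose * N).trace := h6
    rw [h6]
    simp
    ring
  have h7 : (N.conjTranspose * N).trace = ((∑ j, ∑ i, ‖N i j‖ ^ 2 : ℝ) : ℂ) := by
    simp only [Matrix.trace, Matrix.diag, Matrix.mul_apply, Matrix.conjTranspose_apply]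
    push_cast
    refine Finset.sum_congr rfl fun j _ => Finset.sum_congr rfl fun i _ => ?_
    exact RCLike.conj_mul (N i j)
  have h8 : ∑ i, (hH.eigenvalues i - 1) = 2 * N.trace.re + ∑ j, ∑ i, ‖N i j‖ ^ 2 := by
    apply Complex.ofReal_injective
    rw [h3, h7, RCLike.star_def, RCLike.add_conj]
    push_cast
    rfl
  calc ‖M.det‖ ^ 2 = ∏ i, hH.eigenvalues i := h1'
    _ ≤ ∏ i, Real.exp (hH.eigenvalues i - 1) := by
        refine Finset.prod_le_prod (fun i _ => hM.eigenvalues_nonneg i) fun i _ => ?_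
        linarith [Real.add_one_le_exp (hH.eigenvalues i - 1)]
    _ = Real.exp (∑ i, (hH.eigenvalues i - 1)) := (Real.exp_sum _ _).symm
    _ ≤ _ := by
        rw [h8]
        gcongr
        exact Complex.re_le_norm _

theorem trace_compressionMatrix_le {F : H →L[ℂ] H} (W : Submodule ℂ H) [FiniteDimensional ℂ W]
    {R : ℝ} (hR : 0 ≤ R) (hF : traceNorm F ≤ ENNReal.ofReal R) :
    ‖(compressionMatrix W F).trace‖ ≤ R := by
  have ho : Orthonormal ℂ fun i => (stdOrthonormalBasis ℂ W i : H) :=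
    (stdOrthonormalBasis ℂ W).orthonormal.comp_linearIsometry W.subtypeₗᵢ
  have h := (tsum_enorm_inner_le_traceNorm ho
    (ContinuousLinearMap.norm_id_le (𝕜 := ℂ) (E := H)) F).trans hF
  rw [tsum_fintype] at h
  rw [← ENNReal.ofReal_le_ofReal_iff hR, ofReal_norm]
  exact (enorm_sum_le _ _).trans h

theorem sum_norm_compressionMatrix_sq_le {F : H →L[ℂ] H} (W : Submodule ℂ H)
    [FiniteDimensional ℂ W] {R : ℝ} (hR : 0 ≤ R) (hF : traceNorm F ≤ ENNReal.ofReal R) :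
    ∑ j, ∑ i, ‖compressionMatrix W F i j‖ ^ 2 ≤ R ^ 2 := by
  have ho : Orthonormal ℂ fun i => (stdOrthonormalBasis ℂ W i : H) :=
    (stdOrthonormalBasis ℂ W).orthonormal.comp_linearIsometry W.subtypeₗᵢ
  obtain ⟨X, Y, hXY, hX, hY⟩ := exists_hsSq_factorization F
  have h1 : ∀ j, ∑ i, ‖compressionMatrix W F i j‖ₑ ^ 2 ≤
      hsSq X * ‖Y (stdOrthonormalBasis ℂ W j)‖ₑ ^ 2 := fun j => by
    have := tsum_enorm_inner_sq_le ho (F (stdOrthonormalBasis ℂ W j))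
    rw [tsum_fintype] at this
    refine this.trans ?_
    conv_lhs => rw [hXY]
    exact enorm_apply_sq_le_hsSq X _
  have h2 : ∑ j, ∑ i, ‖compressionMatrix W F i j‖ₑ ^ 2 ≤ ENNReal.ofReal (R ^ 2) := by
    refine (Finset.sum_le_sum fun j _ => h1 j).trans ?_
    rw [← Finset.mul_sum, ENNReal.ofReal_pow hR, pow_two (ENNReal.ofReal R)]
    refine mul_le_mul' (hX.trans hF) (le_trans ?_ (hY.trans hF))
    have := tsum_enorm_apply_sq_le_hsSq ho Y
    rwa [tsum_fintype] at this
  rw [← ENNReal.ofReal_le_ofReal_iff (by positivity)]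
  refine le_trans (le_of_eq ?_) h2
  rw [ENNReal.ofReal_sum_of_nonneg fun _ _ => by positivity]
  refine Finset.sum_congr rfl fun j _ => ?_
  rw [ENNReal.ofReal_sum_of_nonneg fun _ _ => by positivity]
  refine Finset.sum_congr rfl fun i _ => ?_
  rw [ENNReal.ofReal_pow (norm_nonneg _), ofReal_norm]

theorem norm_finiteRankDet_le {F : H →L[ℂ] H} [FiniteDimensional ℂ F.range] {R : ℝ} (hR : 0 ≤ R)
    (hF : traceNorm F ≤ ENNReal.ofReal R) : ‖finiteRankDet F‖ ≤ Real.exp (2 * R + R ^ 2) := by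
  rw [finiteRankDet_eq_det_compressionMatrix (W := F.range) fun x => ⟨x, rfl⟩]
  have h := (norm_det_one_add_sq_le (compressionMatrix F.range F)).trans
    (Real.exp_le_exp.2 (add_le_add (mul_le_mul_of_nonneg_left
      (trace_compressionMatrix_le F.range hR hF) two_pos.le)
      (sum_norm_compressionMatrix_sq_le F.range hR hF)))
  -- The exponential bounds the square of the norm; being at least `1`, it is at most its own
  -- square.
  have h1 : 1 ≤ Real.exp (2 * R + R ^ 2) := Real.one_le_exp (by positivity)
  refine le_of_sq_le_sq (h.trans ?_) (by positivity)
  nlinarith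

/-- On a fixed `W` containing all the ranges, the determinant is a polynomial in matrix entries that
depend linearly on `Φ e`. -/
theorem differentiable_finiteRankDet_comp {E : Type*} [NormedAddCommGroup E] [NormedSpace ℂ E]
    {Φ : E → H →L[ℂ] H} (hΦ : Differentiable ℂ Φ) (W : Submodule ℂ H) [FiniteDimensional ℂ W]
    (hW : ∀ e x, Φ e x ∈ W) : Differentiable ℂ fun e => finiteRankDet (Φ e) := by
  have h1 : (fun e => finiteRankDet (Φ e)) = fun e => (1 + compressionMatrix W (Φ e)).det :=
    funext fun e => finiteRankDet_eq_det_compressionMatrix (hW e)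
  rw [h1]
  simp only [Matrix.det_apply]
  refine Differentiable.fun_sum fun σ _ => ?_
  simp only [Units.smul_def, zsmul_eq_mul]
  refine Differentiable.const_mul ?_ _
  intro e
  refine (HasFDerivAt.finsetProd fun i _ => DifferentiableAt.hasFDerivAt ?_).differentiableAt
  simp only [Matrix.add_apply, compressionMatrix, Matrix.of_apply]
  refine DifferentiableAt.const_add _ ?_
  exact (innerSL ℂ _).differentiableAt.comp e ((hΦ e).clm_apply (differentiableAt_const _))

/-- A modulus of continuity for the determinant on balls for the trace norm. -/
def detModulus (R : ℝ) : ℝ := 2 * Real.exp (2 * (R + 1) + (R + 1) ^ 2)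

theorem detModulus_pos (R : ℝ) : 0 < detModulus R := by
  unfold detModulus
  positivity

/-- Schwarz lemma for `z ↦ det (1 + F + z (G - F))` on the disc of radius `δ⁻¹`. There the trace
norm stays at most `R + 1`, so the values lie within `detModulus R` of the value at `0`; the point
`z = 1`, in the disc because `δ < 1`, gives the factor `δ`. -/
theorem dist_finiteRankDet_le {F G : H →L[ℂ] H} [FiniteDimensional ℂ F.range]
    [FiniteDimensional ℂ G.range] {R δ : ℝ} (hR : 0 ≤ R) (hδ : 0 < δ) (hδ1 : δ < 1)
    (hF : traceNorm F ≤ ENNReal.ofReal R) (hFG : traceNorm (G - F) ≤ ENNReal.ofReal δ) :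
    dist (finiteRankDet G) (finiteRankDet F) ≤ detModulus R * δ := by
  let W := F.range ⊔ G.range
  have hFW : ∀ x, F x ∈ W := fun x => Submodule.mem_sup_left ⟨x, rfl⟩
  have hGW : ∀ x, G x ∈ W := fun x => Submodule.mem_sup_right ⟨x, rfl⟩
  let Φ : ℂ → H →L[ℂ] H := fun z => F + z • (G - F)
  have hΦW : ∀ z x, Φ z x ∈ W := fun z x =>
    W.add_mem (hFW x) (W.smul_mem _ (W.sub_mem (hGW x) (hFW x)))
  have hΦd : Differentiable ℂ Φ := by fun_prop
  have hd := differentiable_finiteRankDet_comp hΦd W hΦW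
  have hbound : ∀ z ∈ Metric.ball (0 : ℂ) δ⁻¹, ‖finiteRankDet (Φ z)‖ ≤
      Real.exp (2 * (R + 1) + (R + 1) ^ 2) := fun z hz => by
    have : FiniteDimensional ℂ (Φ z).range :=
      Submodule.finiteDimensional_of_le (S₂ := W) (by rintro _ ⟨x, rfl⟩; exact hΦW z x)
    refine norm_finiteRankDet_le (by positivity) ?_
    refine (traceNorm_add_le _ _).trans ?_
    rw [ENNReal.ofReal_add hR zero_le_one, traceNorm_smul]
    refine add_le_add hF ?_
    refine (mul_le_mul_right hFG _).trans ?_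
    rw [← ofReal_norm, ← ENNReal.ofReal_mul (norm_nonneg _)]
    refine ENNReal.ofReal_le_ofReal ?_
    rw [mem_ball_zero_iff, ← one_div, lt_div_iff₀ hδ] at hz
    exact hz.le
  have h0 : (0 : ℂ) ∈ Metric.ball (0 : ℂ) δ⁻¹ := Metric.mem_ball_self (inv_pos.2 hδ)
  have h1 : (1 : ℂ) ∈ Metric.ball (0 : ℂ) δ⁻¹ := by
    rw [mem_ball_zero_iff, norm_one]
    exact (one_lt_inv₀ hδ).2 hδ1
  have hmaps : Set.MapsTo (fun z => finiteRankDet (Φ z)) (Metric.ball 0 δ⁻¹)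
      (Metric.closedBall (finiteRankDet (Φ 0)) (detModulus R)) := fun z hz => by
    rw [Metric.mem_closedBall, dist_eq_norm]
    refine (norm_sub_le _ _).trans ?_
    rw [detModulus, two_mul]
    exact add_le_add (hbound z hz) (hbound 0 h0)
  have h := Complex.dist_le_div_mul_dist_of_mapsTo_ball hd.differentiableOn hmaps h1
  simpa [Φ] using h

/-! ### The Fredholm determinant -/

theorem eventually_finiteRankApprox (K : H →L[ℂ] H) {ε : ℝ≥0∞} (hε : ε ≠ 0) :
    ∀ᶠ F in finiteRankApprox K, FiniteDimensional ℂ F.range ∧ traceNorm (K - F) < ε := by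
  rw [finiteRankApprox, eventually_inf_principal]
  filter_upwards [preimage_mem_comap (Iio_mem_nhds (pos_iff_ne_zero.2 hε))] with F hF hF'
  exact ⟨hF', hF⟩

theorem tendsto_finiteRankApprox_iff {α : Type*} {l : Filter α} {f : α → H →L[ℂ] H}
    {K : H →L[ℂ] H} : Tendsto f l (finiteRankApprox K) ↔
      Tendsto (fun a => traceNorm (K - f a)) l (𝓝 0) ∧
        ∀ᶠ a in l, FiniteDimensional ℂ (f a).range := by
  rw [finiteRankApprox, tendsto_inf, tendsto_comap_iff, tendsto_principal]
  rfl

theorem neBot_finiteRankApprox {K : H →L[ℂ] H} (hK : IsTraceClass K) :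
    (finiteRankApprox K).NeBot := by
  rw [finiteRankApprox, inf_principal_neBot_iff]
  rintro U ⟨V, hV, hVU⟩
  obtain ⟨ε, hε, hεV⟩ := ENNReal.nhds_zero_basis.mem_iff.1 hV
  obtain ⟨F, hF, hF'⟩ := exists_finiteRank_traceNorm_sub_lt hK hε.ne'
  exact ⟨F, hVU (hεV hF'), hF⟩

theorem cauchy_map_finiteRankDet {K : H →L[ℂ] H} (hK : IsTraceClass K) :
    Cauchy (map finiteRankDet (finiteRankApprox K)) := by
  have := neBot_finiteRankApprox hK
  refine Metric.cauchy_iff.2 ⟨inferInstance, fun ε hε => ?_⟩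
  set R := (traceNorm K).toReal + 1 with hR
  have hR0 : 0 ≤ R := by positivity
  have hKR : traceNorm K + 1 = ENNReal.ofReal R := by
    rw [hR, ENNReal.ofReal_add ENNReal.toReal_nonneg zero_le_one, ENNReal.ofReal_toReal hK.ne,
      ENNReal.ofReal_one]
  have hM := detModulus_pos R
  set δ := min (1 / 2) (ε / (2 * detModulus R)) with hδ
  have hδ0 : 0 < δ := by positivity
  have hδ1 : δ < 1 := (min_le_left _ _).trans_lt (by norm_num)
  have hδε : detModulus R * δ < ε := by
    calc detModulus R * δ ≤ detModulus R * (ε / (2 * detModulus R)) := by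
          gcongr
          exact min_le_right _ _
      _ = ε / 2 := by field_simp
      _ < ε := half_lt_self hε
  -- Two approximants within `δ / 2` of `K` are within `δ` of each other and have trace norm at most
  -- `R`.
  have hδ2 : ENNReal.ofReal (δ / 2) ≠ 0 := by simpa using hδ0
  refine ⟨_, image_mem_map (eventually_finiteRankApprox K hδ2), ?_⟩
  rintro _ ⟨F, ⟨hF, hF'⟩, rfl⟩ _ ⟨G, ⟨hG, hG'⟩, rfl⟩
  refine (dist_finiteRankDet_le hR0 hδ0 hδ1 ?_ ?_).trans_lt hδε
  · rw [← hKR]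
    have h1 : G = K - (K - G) := by abel
    rw [h1]
    refine (traceNorm_sub_le _ _).trans (add_le_add le_rfl (hG'.le.trans ?_))
    exact ENNReal.ofReal_le_one.2 (by linarith)
  · have h1 : F - G = (K - G) - (K - F) := by abel
    rw [h1]
    refine (traceNorm_sub_le _ _).trans ((add_le_add hG'.le hF'.le).trans_eq ?_)
    rw [← ENNReal.ofReal_add (by positivity) (by positivity), add_halves]

/-- By completeness of `ℂ` the limit exists, so the default value of `limUnder` plays no role for
trace class `K`. -/
theorem tendsto_finiteRankDet {K : H →L[ℂ] H} (hK : IsTraceClass K) :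
    Tendsto finiteRankDet (finiteRankApprox K) (𝓝 (fredholmDet (1 + K))) := by
  have h := (cauchy_map_finiteRankDet hK).le_nhds_lim
  have h1 : 1 + K - 1 = K := by abel
  rw [fredholmDet, h1]
  exact h

theorem fredholmDet_one_add_of_finiteRank (F : H →L[ℂ] H) [FiniteDimensional ℂ F.range] :
    fredholmDet (1 + F) = finiteRankDet F := by
  have h := tendsto_finiteRankDet (isTraceClass_of_finiteDimensional_range F)
  have h1 : Tendsto (fun _ : ℕ => F) atTop (finiteRankApprox F) :=
    tendsto_finiteRankApprox_iff.2 ⟨by simp, Eventually.of_forall fun _ => ‹_›⟩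
  exact tendsto_nhds_unique (h.comp h1) tendsto_const_nhds

theorem dist_fredholmDet_finiteRankDet_le {K F : H →L[ℂ] H} (hK : IsTraceClass K)
    [FiniteDimensional ℂ F.range] {R δ : ℝ} (hR : 0 ≤ R) (hδ : 0 < δ) (hδ1 : δ < 1)
    (hF : traceNorm F ≤ ENNReal.ofReal R) (hKF : traceNorm (K - F) < ENNReal.ofReal δ) :
    dist (fredholmDet (1 + K)) (finiteRankDet F) ≤ detModulus R * δ := by
  have := neBot_finiteRankApprox hK
  refine le_of_tendsto ((tendsto_finiteRankDet hK).dist tendsto_const_nhds) ?_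
  -- The strict inequality leaves room: `G` closer to `K` than `δ - traceNorm (K - F)` is within `δ`
  -- of `F`.
  filter_upwards [eventually_finiteRankApprox K (tsub_pos_of_lt hKF).ne'] with G ⟨hG, hG'⟩
  refine dist_finiteRankDet_le hR hδ hδ1 hF ?_
  have h1 : G - F = (K - F) - (K - G) := by abel
  rw [h1]
  refine (traceNorm_sub_le _ _).trans ((add_le_add le_rfl hG'.le).trans_eq ?_)
  exact add_tsub_cancel_of_le hKF.le

@[simp]
theorem fredholmDet_one : fredholmDet (1 : H →L[ℂ] H) = 1 := by
  have h0 : ∀ x : H, (0 : H →L[ℂ] H) x ∈ (⊥ : Submodule ℂ H) := fun x => by simp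
  have : FiniteDimensional ℂ (0 : H →L[ℂ] H).range :=
    Submodule.finiteDimensional_of_le (S₂ := ⊥) (by rintro _ ⟨x, rfl⟩; exact h0 x)
  have h := fredholmDet_one_add_of_finiteRank (0 : H →L[ℂ] H)
  rw [add_zero] at h
  rw [h, finiteRankDet_eq_det_of_range_le h0]
  exact LinearMap.det_eq_one_of_subsingleton _

theorem IsTraceClass.add {A B : H →L[ℂ] H} (hA : IsTraceClass A) (hB : IsTraceClass B) :
    IsTraceClass (A + B) :=
  (traceNorm_add_le A B).trans_lt (ENNReal.add_lt_top.2 ⟨hA, hB⟩)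

theorem IsTraceClass.sub {A B : H →L[ℂ] H} (hA : IsTraceClass A) (hB : IsTraceClass B) :
    IsTraceClass (A - B) :=
  (traceNorm_sub_le A B).trans_lt (ENNReal.add_lt_top.2 ⟨hA, hB⟩)

theorem IsTraceClass.mul_right {A : H →L[ℂ] H} (hA : IsTraceClass A) (B : H →L[ℂ] H) :
    IsTraceClass (A * B) :=
  (traceNorm_mul_le_right A B).trans_lt (ENNReal.mul_lt_top enorm_lt_top hA)

theorem fredholmDet_one_add_mul_one_add {K L : H →L[ℂ] H} (hK : IsTraceClass K)
    (hL : IsTraceClass L) :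
    fredholmDet ((1 + K) * (1 + L)) = fredholmDet (1 + K) * fredholmDet (1 + L) := by
  have hKL : IsTraceClass (K + L + K * L) := (hK.add hL).add (hK.mul_right L)
  have h1 : (1 + K) * (1 + L) = 1 + (K + L + K * L) := by noncomm_ring
  rw [h1]
  have := neBot_finiteRankApprox hK
  have := neBot_finiteRankApprox hL
  let l := finiteRankApprox K ×ˢ finiteRankApprox L
  have hF := tendsto_finiteRankApprox_iff.1 (tendsto_fst (f := finiteRankApprox K)
    (g := finiteRankApprox L))
  have hG := tendsto_finiteRankApprox_iff.1 (tendsto_snd (f := finiteRankApprox K)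
    (g := finiteRankApprox L))
  have hT : Tendsto (fun p : (H →L[ℂ] H) × (H →L[ℂ] H) => p.1 + p.2 + p.1 * p.2) l
      (finiteRankApprox (K + L + K * L)) := by
    refine tendsto_finiteRankApprox_iff.2 ⟨?_, ?_⟩
    · have hlim : Tendsto (fun p : (H →L[ℂ] H) × (H →L[ℂ] H) =>
          traceNorm (K - p.1) + traceNorm (L - p.2) + ‖K‖ₑ * traceNorm (L - p.2) +
            (‖L‖ₑ * traceNorm (K - p.1) + traceNorm (L - p.2) * traceNorm (K - p.1))) l
          (𝓝 (0 + 0 + ‖K‖ₑ * 0 + (‖L‖ₑ * 0 + 0 * 0))) :=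
        ((hF.1.add hG.1).add (ENNReal.Tendsto.const_mul hG.1 (Or.inr enorm_ne_top))).add
          ((ENNReal.Tendsto.const_mul hF.1 (Or.inr enorm_ne_top)).add
            (ENNReal.Tendsto.mul hG.1 (Or.inr ENNReal.zero_ne_top) hF.1
              (Or.inr ENNReal.zero_ne_top)))
      simp only [mul_zero, add_zero] at hlim
      refine tendsto_of_tendsto_of_tendsto_of_le_of_le tendsto_const_nhds hlim
        (fun _ => zero_le) fun p => ?_
      -- Only the fixed operators `K`, `L` and the two small differences occur, so no bound on the
      -- approximants is required.
      have h2 : K + L + K * L - (p.1 + p.2 + p.1 * p.2) =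
          (K - p.1) + (L - p.2) + K * (L - p.2) +
            ((K - p.1) * L - (K - p.1) * (L - p.2)) := by noncomm_ring
      dsimp only
      rw [h2]
      refine (traceNorm_add_le _ _).trans (add_le_add ((traceNorm_add_le _ _).trans
        (add_le_add (traceNorm_add_le _ _) (traceNorm_mul_le_left _ _)))
        ((traceNorm_sub_le _ _).trans (add_le_add (traceNorm_mul_le_right _ _)
          ((traceNorm_mul_le_right _ _).trans ?_))))
      gcongr
      exact enorm_le_traceNorm _
    · filter_upwards [hF.2, hG.2] with p hp hp'
      refine Submodule.finiteDimensional_of_le (S₂ := p.1.range ⊔ p.2.range) ?_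
      rintro _ ⟨x, rfl⟩
      exact Submodule.add_mem _ (Submodule.add_mem _ (Submodule.mem_sup_left ⟨x, rfl⟩)
        (Submodule.mem_sup_right ⟨x, rfl⟩)) (Submodule.mem_sup_left ⟨p.2 x, rfl⟩)
  refine tendsto_nhds_unique ((tendsto_finiteRankDet hKL).comp hT) ?_
  refine (((tendsto_finiteRankDet hK).comp tendsto_fst).mul
    ((tendsto_finiteRankDet hL).comp tendsto_snd)).congr' ?_
  filter_upwards [hF.2, hG.2] with p hp hp'
  exact finiteRankDet_one_add_mul.symm

/-! ### The cocycle -/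

/-- For trace class `A`, `B` this exhibits the argument of the determinant as identity plus trace
class. -/
theorem add_mul_inverse_add {A B T : H →L[ℂ] H} (hB : IsUnit (T + B)) :
    (T + A) * Ring.inverse (T + B) = 1 + (A - B) * Ring.inverse (T + B) := by
  have h : T + A = (T + B) + (A - B) := by abel
  rw [h, add_mul, Ring.mul_inverse_cancel _ hB]

theorem cocycle_eq {A B T : H →L[ℂ] H} (hB : IsUnit (T + B)) :
    cocycle A B T = fredholmDet (1 + (A - B) * Ring.inverse (T + B)) := by
  rw [cocycle, add_mul_inverse_add hB]

theorem cocycle_self {A T : H →L[ℂ] H} (hA : IsUnit (T + A)) : cocycle A A T = 1 := by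
  rw [cocycle, Ring.mul_inverse_cancel _ hA, fredholmDet_one]

theorem cocycle_mul_cocycle {A B C T : H →L[ℂ] H} (hA : IsTraceClass A) (hB : IsTraceClass B)
    (hC : IsTraceClass C) (hTB : IsUnit (T + B)) (hTC : IsUnit (T + C)) :
    cocycle A B T * cocycle B C T = cocycle A C T := by
  rw [cocycle_eq hTB, cocycle_eq hTC,
    ← fredholmDet_one_add_mul_one_add ((hA.sub hB).mul_right _) ((hB.sub hC).mul_right _),
    ← add_mul_inverse_add hTB, ← add_mul_inverse_add hTC, cocycle]
  congr 1
  rw [mul_assoc, ← mul_assoc (Ring.inverse (T + B)), Ring.inverse_mul_cancel _ hTB, one_mul]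

/-! ### Holomorphy of the cocycle -/

section Holomorphic

variable {E F : Type*} [NormedAddCommGroup E] [NormedSpace ℂ E] [NormedAddCommGroup F]
  [NormedSpace ℂ F]

theorem norm_fderiv_le_of_forall_norm_le {f : E → F} {x : E} {r C : ℝ} (hr : 0 < r)
    (hf : DifferentiableOn ℂ f (Metric.ball x r)) (hC : ∀ y ∈ Metric.ball x r, ‖f y‖ ≤ C) :
    ‖fderiv ℂ f x‖ ≤ 2 * C / r := by
  refine Complex.norm_fderiv_le_div_of_mapsTo_ball hf (fun y hy => ?_) hr
  rw [Metric.mem_closedBall, dist_eq_norm, two_mul]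
  exact (norm_sub_le _ _).trans (add_le_add (hC y hy) (hC x (Metric.mem_ball_self hr)))

/-- A uniform limit of holomorphic functions on a ball of a normed space is holomorphic. -/
theorem differentiableAt_of_tendstoUniformlyOn_ball [CompleteSpace F] {f : ℕ → E → F} {g : E → F}
    {x : E} {r : ℝ} (hr : 0 < r) (hf : ∀ n, DifferentiableOn ℂ (f n) (Metric.ball x r))
    (hfg : TendstoUniformlyOn f g atTop (Metric.ball x r)) : DifferentiableAt ℂ g x := by
  have hsub : ∀ y ∈ Metric.ball x (r / 2), Metric.ball y (r / 2) ⊆ Metric.ball x r := fun y hy =>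
    Metric.ball_subset_ball' (by rw [Metric.mem_ball] at hy; linarith)
  have hmem : ∀ y ∈ Metric.ball x (r / 2), y ∈ Metric.ball x r := fun y hy =>
    Metric.ball_subset_ball (by linarith) hy
  have hd : ∀ n, ∀ y ∈ Metric.ball x (r / 2), DifferentiableAt ℂ (f n) y := fun n y hy =>
    (hf n).differentiableAt (Metric.isOpen_ball.mem_nhds (hmem y hy))
  -- Cauchy estimates on balls of radius `r / 2` pass uniform smallness from differences to their
  -- derivatives; a bound `ε r / 8` on the functions becomes `ε / 2`.
  have hC : UniformCauchySeqOn (fun n => fderiv ℂ (f n)) atTop (Metric.ball x (r / 2)) := by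
    rw [Metric.uniformCauchySeqOn_iff]
    intro ε hε
    obtain ⟨N, hN⟩ := Metric.uniformCauchySeqOn_iff.1 hfg.uniformCauchySeqOn (ε * r / 8)
      (by positivity)
    refine ⟨N, fun m hm n hn y hy => ?_⟩
    rw [dist_eq_norm, ← fderiv_sub (hd m y hy) (hd n y hy)]
    refine (norm_fderiv_le_of_forall_norm_le (half_pos hr)
      (((hf m).mono (hsub y hy)).sub ((hf n).mono (hsub y hy)))
      (fun z hz => (dist_eq_norm (f m z) (f n z) ▸ (hN m hm n hn z (hsub y hy hz)).le :
        ‖(f m - f n) z‖ ≤ ε * r / 8))).trans_lt ?_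
    have : 2 * (ε * r / 8) / (r / 2) = ε / 2 := by field_simp; ring
    rw [this]
    exact half_lt_self hε
  have hlim : ∀ y, ∃ D, y ∈ Metric.ball x (r / 2) →
      Tendsto (fun n => fderiv ℂ (f n) y) atTop (𝓝 D) := fun y => by
    by_cases hy : y ∈ Metric.ball x (r / 2)
    · obtain ⟨D, hD⟩ := cauchySeq_tendsto_of_complete (hC.cauchySeq hy)
      exact ⟨D, fun _ => hD⟩
    · exact ⟨0, fun h => absurd h hy⟩
  choose g' hg' using hlim
  exact (hasFDerivAt_of_tendstoUniformlyOn Metric.isOpen_ball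
    (hC.tendstoUniformlyOn_of_tendsto hg') (fun n y hy => (hd n y hy).hasFDerivAt)
    (fun y hy => hfg.tendsto_at (hmem y hy)) (Metric.mem_ball_self (half_pos hr))).differentiableAt

end Holomorphic

theorem exists_seq_finiteRank_tendsto {K : H →L[ℂ] H} (hK : IsTraceClass K) :
    ∃ F : ℕ → H →L[ℂ] H, (∀ n, FiniteDimensional ℂ (F n).range) ∧
      Tendsto (fun n => traceNorm (K - F n)) atTop (𝓝 0) := by
  have h : ∀ n : ℕ, (n : ℝ≥0∞)⁻¹ ≠ 0 := fun n => ENNReal.inv_ne_zero.2 (ENNReal.natCast_ne_top n)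
  choose F hF hF' using fun n : ℕ => exists_finiteRank_traceNorm_sub_lt hK (h n)
  exact ⟨F, hF, tendsto_of_tendsto_of_tendsto_of_le_of_le tendsto_const_nhds
    ENNReal.tendsto_inv_nat_nhds_zero (fun _ => zero_le) fun n => (hF' n).le⟩

theorem tendstoUniformlyOn_finiteRankDet_mul {K : H →L[ℂ] H} (hK : IsTraceClass K)
    {F : ℕ → H →L[ℂ] H} (hF : ∀ n, FiniteDimensional ℂ (F n).range)
    (hlim : Tendsto (fun n => traceNorm (K - F n)) atTop (𝓝 0)) {α : Type*} {S : α → H →L[ℂ] H}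
    {s : Set α} {C : ℝ} (hC : ∀ a ∈ s, ‖S a‖ ≤ C) :
    TendstoUniformlyOn (fun n a => finiteRankDet (F n * S a))
      (fun a => fredholmDet (1 + K * S a)) atTop s := by
  rcases s.eq_empty_or_nonempty with rfl | ⟨a₀, ha₀⟩
  · exact tendstoUniformlyOn_empty
  have hC0 : 0 ≤ C := (norm_nonneg _).trans (hC a₀ ha₀)
  have hCe : ∀ a ∈ s, ‖S a‖ₑ ≤ ENNReal.ofReal C := fun a ha => by
    rw [← ofReal_norm]
    exact ENNReal.ofReal_le_ofReal (hC a ha)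
  -- This bounds `traceNorm (F n * S a)` for all `a ∈ s` once `traceNorm (K - F n) < 1`, so one
  -- Lipschitz constant serves all of `s`.
  set R := C * ((traceNorm K).toReal + 1) with hR
  have hR0 : 0 ≤ R := by positivity
  have hM := detModulus_pos R
  refine Metric.tendstoUniformlyOn_iff.2 fun ε hε => ?_
  set δ := min (1 / 2) (ε / (2 * detModulus R)) with hδ
  have hδ0 : 0 < δ := by positivity
  have hδ1 : δ < 1 := (min_le_left _ _).trans_lt (by norm_num)
  have hδε : detModulus R * δ < ε := by
    calc detModulus R * δ ≤ detModulus R * (ε / (2 * detModulus R)) := by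
          gcongr
          exact min_le_right _ _
      _ = ε / 2 := by field_simp
      _ < ε := half_lt_self hε
  have hlim' : Tendsto (fun n => ENNReal.ofReal C * traceNorm (K - F n)) atTop (𝓝 0) := by
    simpa using ENNReal.Tendsto.const_mul (a := ENNReal.ofReal C) hlim
      (Or.inr ENNReal.ofReal_ne_top)
  filter_upwards [hlim.eventually_lt_const zero_lt_one,
    hlim'.eventually_lt_const (ENNReal.ofReal_pos.2 hδ0)] with n hn hn' a ha
  have : FiniteDimensional ℂ (F n * S a).range :=
    Submodule.finiteDimensional_of_le (S₂ := (F n).range) (by rintro _ ⟨x, rfl⟩; exact ⟨S a x, rfl⟩)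
  refine (dist_fredholmDet_finiteRankDet_le (hK.mul_right (S a)) hR0 hδ0 hδ1 ?_ ?_).trans_lt hδε
  · refine (traceNorm_mul_le_right _ _).trans ?_
    rw [hR, ENNReal.ofReal_mul hC0, ENNReal.ofReal_add ENNReal.toReal_nonneg zero_le_one,
      ENNReal.ofReal_toReal hK.ne, ENNReal.ofReal_one]
    refine mul_le_mul' (hCe a ha) ?_
    have h1 : F n = K - (K - F n) := by abel
    rw [h1]
    exact (traceNorm_sub_le _ _).trans (add_le_add le_rfl hn.le)
  · rw [← sub_mul]
    exact ((traceNorm_mul_le_right _ _).trans (mul_le_mul' (hCe a ha) le_rfl)).trans_lt hn'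

theorem isOpen_setOf_isUnit_add (A : H →L[ℂ] H) : IsOpen {T : H →L[ℂ] H | IsUnit (T + A)} :=
  Units.isOpen.preimage (continuous_id.add continuous_const)

theorem differentiableAt_inverse_add {A T : H →L[ℂ] H} (h : IsUnit (T + A)) :
    DifferentiableAt ℂ (fun T' : H →L[ℂ] H => Ring.inverse (T' + A)) T := by
  obtain ⟨u, hu⟩ := h
  have h1 : DifferentiableAt ℂ (Ring.inverse : (H →L[ℂ] H) → H →L[ℂ] H) (T + A) := by
    rw [← hu]
    exact differentiableAt_inverse (𝕜 := ℂ) u.isUnit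
  exact h1.comp T (differentiableAt_id.add_const A)

/-- Approximate `A - B` by finite rank `F n`. Near `T` the inverses of `T' + B` stay bounded, so
`det (1 + F n (T' + B)⁻¹)` converges uniformly to the cocycle; each approximant is holomorphic
because the ranges lie in that of `F n`. -/
theorem differentiableAt_cocycle {A B : H →L[ℂ] H} (hA : IsTraceClass A) (hB : IsTraceClass B)
    {T : H →L[ℂ] H} (hT : IsUnit (T + B)) : DifferentiableAt ℂ (cocycle A B) T := by
  have hK := hA.sub hB
  obtain ⟨F, hF, hlim⟩ := exists_seq_finiteRank_tendsto hK
  have hev : ∀ᶠ T' in 𝓝 T, IsUnit (T' + B) ∧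
      ‖Ring.inverse (T' + B)‖ ≤ ‖Ring.inverse (T + B)‖ + 1 := by
    refine ((isOpen_setOf_isUnit_add B).eventually_mem hT).and ?_
    exact ((differentiableAt_inverse_add hT).continuousAt.norm.eventually_lt_const
      (lt_add_one _)).mono fun _ h => h.le
  obtain ⟨r, hr, hball⟩ := Metric.eventually_nhds_iff_ball.1 hev
  have hunif := tendstoUniformlyOn_finiteRankDet_mul hK hF hlim (s := Metric.ball T r)
    (S := fun T' => Ring.inverse (T' + B)) fun T' hT' => (hball T' hT').2
  have hd : ∀ n, DifferentiableOn ℂ (fun T' => finiteRankDet (F n * Ring.inverse (T' + B)))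
      (Metric.ball T r) := fun n T' hT' => by
    have hmul : Differentiable ℂ fun S : H →L[ℂ] H => F n * S := by fun_prop
    have := hF n
    have h1 := differentiable_finiteRankDet_comp hmul (F n).range fun S x => ⟨S x, rfl⟩
    exact ((h1 _).comp T' (differentiableAt_inverse_add
      (hball T' hT').1)).differentiableWithinAt
  refine (differentiableAt_of_tendstoUniformlyOn_ball hr hd hunif).congr_of_eventuallyEq ?_
  filter_upwards [hev] with T' hT'
  exact cocycle_eq hT'.1

/-! ### Top exterior powers -/

section ExteriorPower

variable {M N : Type*} [AddCommGroup M] [Module ℂ M] [AddCommGroup N] [Module ℂ N]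

theorem alternatingMap_apply_eq_det_smul {ι : Type*} [Fintype ι] [DecidableEq ι]
    (f : M [⋀^ι]→ₗ[ℂ] N) (b : Module.Basis ι ℂ M) (v : ι → M) : f v = b.det v • f b := by
  have h : f = (LinearMap.toSpanSingleton ℂ N (f b)).compAlternatingMap b.det := by
    refine b.ext_alternating fun σ hσ => ?_
    let τ : Equiv.Perm ι := Equiv.ofBijective σ (Finite.injective_iff_bijective.1 hσ)
    have h1 : (fun i => b (σ i)) = b ∘ τ := rfl
    rw [h1, AlternatingMap.map_perm, AlternatingMap.map_perm]
    simp [b.det_self]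
  conv_lhs => rw [h]
  rfl

theorem ιMulti_basis_ne_zero {n : ℕ} (b : Module.Basis (Fin n) ℂ M) :
    exteriorPower.ιMulti ℂ n b ≠ 0 := by
  intro h
  have h1 := exteriorPower.alternatingMapLinearEquiv_apply_ιMulti b.det b
  rw [h, map_zero, b.det_self] at h1
  exact zero_ne_one h1

theorem tmul_ne_zero {x : M} {y : N} (hx : x ≠ 0) (hy : y ≠ 0) : x ⊗ₜ[ℂ] y ≠ 0 := by
  obtain ⟨p, hp⟩ := Module.Projective.exists_dual_eq_one ℂ hx
  obtain ⟨q, hq⟩ := Module.Projective.exists_dual_eq_one ℂ hy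
  intro h
  have h1 := congrArg (fun z => TensorProduct.lid ℂ ℂ (TensorProduct.map p q z)) h
  simp [hp, hq] at h1

/-- The two transition matrices are transposes: both have entries `e'ⱼ*(eᵢ)`. -/
theorem dualBasis_det {n : ℕ} (e e' : Module.Basis (Fin n) ℂ M) :
    e.dualBasis.det e'.dualBasis = e'.det e := by
  rw [Module.Basis.det_apply, Module.Basis.det_apply, ← Matrix.det_transpose]
  congr 1
  ext i j
  simp [Module.Basis.toMatrix_apply]

end ExteriorPower

/-! ### The fibres -/

theorem finiteDimensional_coker (T : FredholmZero H) : FiniteDimensional ℂ (Coker T) :=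
  T.2.1.finite_coker

theorem exists_isAdmissible (T : FredholmZero H) : ∃ L, IsAdmissible T L := by
  have := finiteDimensional_coker T
  obtain ⟨s, hs⟩ := (rho T).exists_rightInverse_of_surjective (Submodule.range_mkQ _)
  let e : Ker T ≃ₗ[ℂ] Coker T := LinearEquiv.ofFinrankEq _ _ T.2.2
  refine ⟨s ∘ₗ e.toLinearMap, ?_⟩
  rw [IsAdmissible, ← LinearMap.comp_assoc, hs]
  exact e.bijective

/-- `T` maps the complement of its kernel isomorphically onto its range, and `L` maps the kernel
onto a complement of that range. -/
theorem extendByZero_mem_regularizers {T : FredholmZero H} {L : Ker T →ₗ[ℂ] H}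
    (hL : IsAdmissible T L) : extendByZero T L ∈ regularizers T := by
  refine ⟨?_, ?_⟩
  · have : FiniteDimensional ℂ (extendByZero T L).range :=
      Submodule.finiteDimensional_of_le (S₂ := LinearMap.range L)
        (by rintro _ ⟨x, rfl⟩; exact ⟨_, rfl⟩)
    exact isTraceClass_of_finiteDimensional_range _
  · have happ : ∀ x, (T.1 + extendByZero T L) x =
        T.1 x + L ((Ker T).orthogonalProjectionOnto x) := fun x => rfl
    have hρ : ∀ x, rho T (T.1 x) = 0 := fun x =>
      (Submodule.Quotient.mk_eq_zero _).2 ⟨x, rfl⟩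
    rw [ContinuousLinearMap.isUnit_iff_bijective]
    refine ⟨(injective_iff_map_eq_zero _).2 fun x hx => ?_, fun y => ?_⟩
    · rw [happ] at hx
      have h1 : (rho T ∘ₗ L) ((Ker T).orthogonalProjectionOnto x) = 0 := by
        have := congrArg (rho T) hx
        rwa [map_add, hρ, zero_add, map_zero] at this
      have h2 : (Ker T).orthogonalProjectionOnto x = 0 := hL.1 (h1.trans (map_zero _).symm)
      rw [h2, map_zero, add_zero] at hx
      have h3 := (Ker T).orthogonalProjectionOnto_mem_subspace_eq_self ⟨x, hx⟩
      rw [h2] at h3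
      exact congrArg Subtype.val h3.symm
    · obtain ⟨k, hk⟩ := hL.2 (rho T y)
      have h1 : y - L k ∈ T.1.range := by
        rw [← Submodule.Quotient.mk_eq_zero]
        exact (map_sub (rho T) y (L k)).trans (sub_eq_zero.2 hk.symm)
      obtain ⟨x, hx⟩ := h1
      -- Exchanging the kernel component of `x` for `k` leaves `T x` unchanged and makes the
      -- projection equal to `k`.
      refine ⟨x - (Ker T).orthogonalProjectionOnto x + k, ?_⟩
      have h2 : ∀ v : Ker T, T.1 (v : H) = 0 := fun v => v.2
      have hx' : T.1 x = y - L k := hx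
      rw [happ, map_add, map_sub, h2, h2, map_add, map_sub,
        Submodule.orthogonalProjectionOnto_mem_subspace_eq_self,
        Submodule.orthogonalProjectionOnto_mem_subspace_eq_self, hx']
      simp

theorem regularizers_nonempty (T : FredholmZero H) : Nonempty (regularizers T) :=
  let ⟨_, hL⟩ := exists_isAdmissible T
  ⟨⟨_, extendByZero_mem_regularizers hL⟩⟩

/-- Evaluation at `A ∈ 𝓐_T` as an isomorphism `𝓓_T ≃ ℂ`. -/
def detFiberEquiv (T : FredholmZero H) (A : regularizers T) : DetFiber T ≃ₗ[ℂ] ℂ where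
  toFun f := f.1 A
  map_add' _ _ := rfl
  map_smul' _ _ := rfl
  invFun z := ⟨fun B => cocycle A.1 B.1 T.1 * z, fun B C => by
    rw [← mul_assoc, mul_comm (cocycle B.1 C.1 T.1),
      cocycle_mul_cocycle A.2.1 B.2.1 C.2.1 B.2.2 C.2.2]⟩
  left_inv f := Subtype.ext (funext fun B => (f.2 A B).symm)
  right_inv z := by
    change cocycle A.1 A.1 T.1 * z = z
    rw [cocycle_self A.2.2, one_mul]

theorem finrank_detFiber (T : FredholmZero H) : Module.finrank ℂ (DetFiber T) = 1 := by
  obtain ⟨A⟩ := regularizers_nonempty T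
  rw [(detFiberEquiv T A).finrank_eq, Module.finrank_self]

/-! ### The map `φ_T` -/

/-- The isomorphism `Ker T ≃ Coker T` induced by an admissible map. -/
def admissibleEquiv {T : FredholmZero H} {L : Ker T →ₗ[ℂ] H} (hL : IsAdmissible T L) :
    Ker T ≃ₗ[ℂ] Coker T :=
  LinearEquiv.ofBijective (rho T ∘ₗ L) hL

/-- The perturbation is `(L - L') ∘ g` with `g = π_T (T + L' π_T)⁻¹`, so its determinant is that of
`1 + g (L - L')` on `Ker T`. Applying `ρ_T` to `(T + L' π_T)(T + L' π_T)⁻¹ = 1` gives `ρ L' g = ρ`,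
hence `ρ L' (1 + g (L - L')) = ρ L`. -/
theorem cocycle_extendByZero {T : FredholmZero H} {L L' : Ker T →ₗ[ℂ] H} (hL : IsAdmissible T L)
    (hL' : IsAdmissible T L') : cocycle (extendByZero T L) (extendByZero T L') T.1 =
      LinearMap.det ((admissibleEquiv hL).trans (admissibleEquiv hL').symm : Ker T →ₗ[ℂ] Ker T) := by
  have hu := (extendByZero_mem_regularizers hL').2
  set S := Ring.inverse (T.1 + extendByZero T L') with hS
  let g : H →ₗ[ℂ] Ker T := ((Ker T).orthogonalProjectionOnto ∘L S : H →L[ℂ] Ker T)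
  have hF : ∀ x, ((extendByZero T L - extendByZero T L') * S) x = (L - L') (g x) := fun x => rfl
  have : FiniteDimensional ℂ ((extendByZero T L - extendByZero T L') * S).range :=
    Submodule.finiteDimensional_of_le (S₂ := LinearMap.range (L - L'))
      (by rintro _ ⟨x, rfl⟩; exact ⟨_, (hF x).symm⟩)
  rw [cocycle_eq hu, fredholmDet_one_add_of_finiteRank, finiteRankDet_comp (L - L') g hF]
  congr 1
  ext1 k
  apply (admissibleEquiv hL').injective
  have hρ : ∀ x, rho T (T.1 x) = 0 := fun x => (Submodule.Quotient.mk_eq_zero _).2 ⟨x, rfl⟩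
  have h1 : ∀ y, rho T (L' (g y)) = rho T y := fun y => by
    have h2 : (T.1 + extendByZero T L') (S y) = y :=
      congrArg (fun A : H →L[ℂ] H => A y) (Ring.mul_inverse_cancel _ hu)
    have h3 : T.1 (S y) + L' (g y) = y := h2
    conv_rhs => rw [← h3]
    rw [map_add, hρ, zero_add]
  have h4 : admissibleEquiv hL' (k + g ((L - L') k)) = admissibleEquiv hL k := by
    change rho T (L' (k + g ((L - L') k))) = rho T (L k)
    rw [map_add, map_add, h1, LinearMap.sub_apply, map_sub, add_sub_cancel]
  simpa using h4

theorem quillenVector_eq_smul {T : FredholmZero H} {L L' : Ker T →ₗ[ℂ] H}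
    (hL : IsAdmissible T L) (hL' : IsAdmissible T L')
    (e e' : Module.Basis (Fin (dimKer T)) ℂ (Ker T)) :
    quillenVector T L e =
      LinearMap.det ((admissibleEquiv hL).trans (admissibleEquiv hL').symm : Ker T →ₗ[ℂ] Ker T) •
        quillenVector T L' e' := by
  -- The two dimensions are equal only propositionally, so bases must be reindexed.
  let σ : Fin (dimKer T) ≃ Fin (dimCoker T) := finCongr T.2.2
  let b' := (e'.reindex σ).map (admissibleEquiv hL')
  have h1 : exteriorPower.ιMulti ℂ (dimKer T) (fun i => e.coord i) =
      e.det e' • exteriorPower.ιMulti ℂ (dimKer T) (fun i => e'.coord i) := by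
    have h := alternatingMap_apply_eq_det_smul
      (exteriorPower.ιMulti ℂ (dimKer T) (M := Module.Dual ℂ (Ker T))) e'.dualBasis e.dualBasis
    rwa [dualBasis_det, Module.Basis.coe_dualBasis, Module.Basis.coe_dualBasis] at h
  have h2 : exteriorPower.ιMulti ℂ (dimCoker T)
      (fun i => rho T (L (e (Fin.cast T.2.2.symm i)))) =
      (LinearMap.det ((admissibleEquiv hL).trans (admissibleEquiv hL').symm :
        Ker T →ₗ[ℂ] Ker T) * e'.det e) • exteriorPower.ιMulti ℂ (dimCoker T)
          (fun i => rho T (L' (e' (Fin.cast T.2.2.symm i)))) := by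
    have h := alternatingMap_apply_eq_det_smul
      (exteriorPower.ιMulti ℂ (dimCoker T) (M := Coker T)) b'
      (fun i => rho T (L (e (Fin.cast T.2.2.symm i))))
    have h3 : b'.det (fun i => rho T (L (e (Fin.cast T.2.2.symm i)))) =
        LinearMap.det ((admissibleEquiv hL).trans (admissibleEquiv hL').symm :
          Ker T →ₗ[ℂ] Ker T) * e'.det e := by
      rw [Module.Basis.det_map, Module.Basis.det_reindex, ← Module.Basis.det_comp]
      rfl
    have h4 : (b' : Fin (dimCoker T) → Coker T) =
        fun i => rho T (L' (e' (Fin.cast T.2.2.symm i))) := by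
      ext i
      simp only [b', Module.Basis.map_apply, Module.Basis.reindex_apply]
      rfl
    rwa [h3, h4] at h
  have h5 : e.det e' * e'.det e = 1 := by rw [Module.Basis.det_mul_det, Module.Basis.det_self]
  rw [quillenVector, quillenVector, h1, h2, TensorProduct.smul_tmul_smul]
  congr 1
  linear_combination (LinearMap.det ((admissibleEquiv hL).trans (admissibleEquiv hL').symm :
          Ker T →ₗ[ℂ] Ker T)) * h5

/-- The defining relation of `𝓓_T`, between `A` and `L ∘ π_T`, absorbs the determinant; the right
side no longer involves `A`. -/
theorem phi_apply {T : FredholmZero H} (A : regularizers T) {L : Ker T →ₗ[ℂ] H}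
    (hL : IsAdmissible T L) (e : Module.Basis (Fin (dimKer T)) ℂ (Ker T)) (f : DetFiber T) :
    phi T A L e f = f.1 ⟨_, extendByZero_mem_regularizers hL⟩ • quillenVector T L e := by
  rw [f.2 A ⟨_, extendByZero_mem_regularizers hL⟩, mul_comm]
  rfl

theorem phi_eq_phi {T : FredholmZero H} (A A' : regularizers T) {L L' : Ker T →ₗ[ℂ] H}
    (e e' : Module.Basis (Fin (dimKer T)) ℂ (Ker T)) (hL : IsAdmissible T L)
    (hL' : IsAdmissible T L') : phi T A L e = phi T A' L' e' := by
  ext1 f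
  rw [phi_apply A hL, phi_apply A' hL', quillenVector_eq_smul hL hL' e e',
    ← cocycle_extendByZero hL hL', smul_smul, f.2 ⟨_, extendByZero_mem_regularizers hL⟩
      ⟨_, extendByZero_mem_regularizers hL'⟩, mul_comm]

theorem quillenVector_ne_zero {T : FredholmZero H} {L : Ker T →ₗ[ℂ] H} (hL : IsAdmissible T L)
    (e : Module.Basis (Fin (dimKer T)) ℂ (Ker T)) : quillenVector T L e ≠ 0 := by
  refine tmul_ne_zero ?_ ?_
  · have := ιMulti_basis_ne_zero e.dualBasis
    rwa [Module.Basis.coe_dualBasis] at this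
  · exact ιMulti_basis_ne_zero ((e.reindex (finCongr T.2.2)).map (admissibleEquiv hL)) |>
      (fun h => by
        convert h using 2
        ext i
        simp only [Module.Basis.map_apply, Module.Basis.reindex_apply]
        rfl)

theorem finrank_quillenFiber (T : FredholmZero H) : Module.finrank ℂ (QuillenFiber T) = 1 := by
  have := finiteDimensional_coker T
  rw [Module.finrank_tensorProduct, exteriorPower.finrank_eq, exteriorPower.finrank_eq,
    Subspace.dual_finrank_eq, Nat.choose_self, Nat.choose_self]

theorem phi_bijective {T : FredholmZero H} (A : regularizers T) {L : Ker T →ₗ[ℂ] H}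
    (hL : IsAdmissible T L) (e : Module.Basis (Fin (dimKer T)) ℂ (Ker T)) :
    Function.Bijective (phi T A L e) := by
  let A' : regularizers T := ⟨_, extendByZero_mem_regularizers hL⟩
  have hv := quillenVector_ne_zero hL e
  refine ⟨(injective_iff_map_eq_zero _).2 fun f hf => ?_, fun w => ?_⟩
  · rw [phi_apply A hL, smul_eq_zero_iff_left hv] at hf
    exact (detFiberEquiv T A').map_eq_zero_iff.1 hf
  · obtain ⟨c, hc⟩ := (finrank_eq_one_iff_of_nonzero' _ hv).1 (finrank_quillenFiber T) w
    refine ⟨(detFiberEquiv T A').symm c, ?_⟩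
    rw [phi_apply A hL, ← hc]
    congr 1
    exact (detFiberEquiv T A').apply_symm_apply c

/-- The isomorphism `φ_T : 𝓓_T ≃ ⋀ (Ker T)* ⊗ ⋀ Coker T`. -/
def phiEquiv (T : FredholmZero H) : DetFiber T ≃ₗ[ℂ] QuillenFiber T :=
  LinearEquiv.ofBijective
    (phi T (regularizers_nonempty T).some (exists_isAdmissible T).choose (Module.finBasis ℂ (Ker T)))
    (phi_bijective _ (exists_isAdmissible T).choose_spec _)

theorem phiEquiv_apply (T : FredholmZero H) (A : regularizers T) {L : Ker T →ₗ[ℂ] H}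
    (e : Module.Basis (Fin (dimKer T)) ℂ (Ker T)) (hL : IsAdmissible T L) (f : DetFiber T) :
    phiEquiv T f = phi T A L e f :=
  LinearMap.congr_fun (phi_eq_phi _ A _ e (exists_isAdmissible T).choose_spec hL) f

/-! ### Transport of line bundles along fibrewise isomorphisms -/

section Transport

variable {B ι : Type*} [TopologicalSpace B] {E : B → Type*} [∀ b, AddCommGroup (E b)]
  [∀ b, Module ℂ (E b)] (Z : VectorBundleCore ℂ B ℂ ι) (ψ : ∀ b, Z.Fiber b ≃ₗ[ℂ] E b)

/-- The bijection of total spaces given by fibrewise linear isomorphisms. -/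
def totalSpaceEquiv : TotalSpace ℂ E ≃ TotalSpace ℂ Z.Fiber where
  toFun p := ⟨p.1, (ψ p.1).symm p.2⟩
  invFun p := ⟨p.1, ψ p.1 p.2⟩
  left_inv p := by simp
  right_inv p := by simp

/-- The topology on the total space of `E` transported from the bundle glued from `Z`. -/
abbrev transportTopology : TopologicalSpace (TotalSpace ℂ E) :=
  .induced (totalSpaceEquiv Z ψ) Z.toTopologicalSpace

/-- The topology on the fibres of `E` transported from the bundle glued from `Z`. -/
abbrev transportFiberTopology (b : B) : TopologicalSpace (E b) :=
  .induced (ψ b).symm (Z.topologicalSpaceFiber b)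

/-- The local trivialization of `E` transported from the bundle glued from `Z`. -/
def transportTriv (i : ι) :
    letI := transportTopology Z ψ
    Trivialization ℂ (π ℂ E) :=
  letI := transportTopology Z ψ
  (Z.localTriv i).compHomeomorph ((totalSpaceEquiv Z ψ).toHomeomorphOfIsInducing ⟨rfl⟩)

/-- The fibre bundle structure on `E` transported from the bundle glued from `Z`. -/
abbrev transportFiberBundle :
    letI := transportTopology Z ψ
    letI := transportFiberTopology Z ψ
    FiberBundle ℂ E :=
  letI := transportTopology Z ψ
  letI := transportFiberTopology Z ψ
  { totalSpaceMk_isInducing' := fun b => by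
      have h1 : IsInducing (totalSpaceEquiv Z ψ) := ⟨rfl⟩
      have h2 : IsInducing (ψ b).symm := ⟨rfl⟩
      exact (h1.of_comp_iff (f := TotalSpace.mk b)).1
        ((FiberBundle.totalSpaceMk_isInducing ℂ Z.Fiber b).comp h2)
    trivializationAtlas' := Set.range (transportTriv Z ψ)
    trivializationAt' := fun b => transportTriv Z ψ (Z.indexAt b)
    mem_baseSet_trivializationAt' := fun b => Z.mem_baseSet_at b
    trivialization_mem_atlas' := fun b => ⟨_, rfl⟩ }

theorem transport_isLinear (i : ι) :
    letI := transportTopology Z ψ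
    (transportTriv Z ψ i).IsLinear ℂ := by
  let := transportTopology Z ψ
  refine ⟨fun b _ => ⟨fun x y => ?_, fun c x => ?_⟩⟩
  · change Z.coordChange (Z.indexAt b) i b ((ψ b).symm (x + y)) = _
    rw [map_add]
    exact map_add (Z.coordChange (Z.indexAt b) i b) _ _
  · change Z.coordChange (Z.indexAt b) i b ((ψ b).symm (c • x)) = _
    rw [map_smul]
    exact map_smul (Z.coordChange (Z.indexAt b) i b) _ _

/-- Both trivializations pass through the coordinate of `Z` at `Z.indexAt b`, so `ψ` cancels and the
cocycle rule of `Z` remains. -/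
theorem transport_coordChangeL (i j : ι) {b : B} (hb : b ∈ Z.baseSet i ∩ Z.baseSet j) :
    letI := transportTopology Z ψ
    letI := transportFiberTopology Z ψ
    haveI := transport_isLinear Z ψ
    ((transportTriv Z ψ i).coordChangeL ℂ (transportTriv Z ψ j) b : ℂ →L[ℂ] ℂ) =
      Z.coordChange i j b := by
  let := transportTopology Z ψ
  let := transportFiberTopology Z ψ
  have := transport_isLinear Z ψ
  ext1
  refine (Trivialization.coordChangeL_apply (transportTriv Z ψ i) (transportTriv Z ψ j)
    hb (1 : ℂ)).trans ?_
  have h1 := congrArg Prod.snd ((transportTriv Z ψ i).apply_mk_symm hb.1 (1 : ℂ))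
  have h2 := Z.coordChange_comp (Z.indexAt b) i j b ⟨⟨Z.mem_baseSet_at b, hb.1⟩, hb.2⟩
    ((ψ b).symm ((transportTriv Z ψ i).symm b 1))
  exact h2.symm.trans (congrArg (Z.coordChange i j b) h1)

theorem transport_vectorBundle :
    letI := transportTopology Z ψ
    letI := transportFiberTopology Z ψ
    letI := transportFiberBundle Z ψ
    VectorBundle ℂ ℂ E := by
  let := transportTopology Z ψ
  let := transportFiberTopology Z ψ
  let := transportFiberBundle Z ψ
  refine ⟨?_, ?_⟩
  · rintro _ ⟨i, rfl⟩
    exact transport_isLinear Z ψ i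
  · rintro _ _ ⟨i, rfl⟩ ⟨j, rfl⟩
    exact (Z.continuousOn_coordChange i j).congr fun b hb => transport_coordChangeL Z ψ i j hb

/-- The line bundle structure on `E` for which the `ψ b` form an isomorphism from the line bundle
glued from `Z`. -/
def transportLineBundle : LineBundleStructure E where
  totalTopology := transportTopology Z ψ
  fiberTopology := transportFiberTopology Z ψ
  fiberBundle := transportFiberBundle Z ψ
  vectorBundle := transport_vectorBundle Z ψ

theorem transportLineBundle_hasTrivialization (i : ι) {U : Set B} (hU : Z.baseSet i = U)
    (c : ∀ b ∈ U, E b → ℂ)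
    (hc : ∀ b hb x, Z.coordChange (Z.indexAt b) i b ((ψ b).symm x) = c b hb x) :
    (transportLineBundle Z ψ).HasTrivialization U c :=
  ⟨transportTriv Z ψ i, ⟨i, rfl⟩, hU, fun b hb x => Prod.ext rfl (hc b hb x)⟩

theorem isLineBundleIso_coreLineBundle :
    IsLineBundleIso (coreLineBundle Z) (transportLineBundle Z ψ) ψ := by
  refine ⟨continuous_induced_rng.2 ?_, continuous_induced_dom⟩
  exact continuous_id.congr fun p => ((totalSpaceEquiv Z ψ).apply_symm_apply p).symm

/-- Both total spaces carry topologies induced from the same glued bundle, and `φ` commutes with the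
two maps to it. -/
theorem isLineBundleIso_transportLineBundle {E' : B → Type*} [∀ b, AddCommGroup (E' b)]
    [∀ b, Module ℂ (E' b)] (φ : ∀ b, E b ≃ₗ[ℂ] E' b) :
    IsLineBundleIso (transportLineBundle Z ψ)
      (transportLineBundle Z fun b => (ψ b).trans (φ b)) φ := by
  let := transportTopology Z ψ
  have h : Continuous (totalSpaceEquiv Z ψ) := continuous_induced_dom
  refine ⟨continuous_induced_rng.2 (h.congr fun p => ?_),
    continuous_induced_rng.2 continuous_induced_dom⟩
  simp [totalSpaceEquiv]

end Transport

/-! ### The determinant line bundle -/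

theorem continuousOn_cocycle (A B : TraceClass H) :
    ContinuousOn (fun T : FredholmZero H => cocycle A.1 B.1 T.1)
      (chartDomain A ∩ chartDomain B) := fun _ hT =>
  ((differentiableAt_cocycle A.2 B.2 hT.2).continuousAt.comp
    continuous_subtype_val.continuousAt).continuousWithinAt

/-- A trace class operator `A` with `T + A` invertible. -/
def indexAt (T : FredholmZero H) : TraceClass H :=
  ⟨(regularizers_nonempty T).some.1, (regularizers_nonempty T).some.2.1⟩

theorem mem_chartDomain_indexAt (T : FredholmZero H) : T ∈ chartDomain (indexAt T) :=
  (regularizers_nonempty T).some.2.2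

variable (H) in
/-- The covering of `𝓕₀` by the sets `𝓤_A`, with the transition functions `g_{A,B}`. -/
def determinantCore : VectorBundleCore ℂ (FredholmZero H) ℂ (TraceClass H) where
  baseSet := chartDomain
  isOpen_baseSet A := (isOpen_setOf_isUnit_add A.1).preimage continuous_subtype_val
  indexAt := indexAt
  mem_baseSet_at := mem_chartDomain_indexAt
  coordChange A B T := cocycle A.1 B.1 T.1 • ContinuousLinearMap.id ℂ ℂ
  coordChange_self A _ hT v := by simp [cocycle_self hT]
  continuousOn_coordChange A B := (continuousOn_cocycle A B).smul continuousOn_const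
  coordChange_comp A B C T hT v := by
    have h := cocycle_mul_cocycle A.2 B.2 C.2 hT.1.2 hT.2
    simp only [smul_apply, ContinuousLinearMap.id_apply, smul_eq_mul]
    rw [← h]
    ring

/-- The isomorphism of the fibre of the glued bundle with `𝓓_T`. -/
def coreFiberEquiv (T : FredholmZero H) : (determinantCore H).Fiber T ≃ₗ[ℂ] DetFiber T :=
  (detFiberEquiv T ⟨(indexAt T).1, (indexAt T).2, mem_chartDomain_indexAt T⟩).symm

/-- A fibre element of the glued bundle is its coordinate in the chart `indexAt T`. Evaluation at
`A` multiplies it by the transition function to `𝓤_A`, so the glued trivialization corresponds to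
`j_A`. -/
theorem coreFiberEquiv_apply (T : FredholmZero H) (x : (determinantCore H).Fiber T)
    (A : TraceClass H) (hT : T ∈ chartDomain A) :
    (coreFiberEquiv T x).1 ⟨A.1, A.2, hT⟩ = (determinantCore H).coordChange (indexAt T) A T x :=
  rfl

end DetLine

end

theorem mainTheorem5 {H : Type*} [NormedAddCommGroup H] [InnerProductSpace ℂ H]
    [CompleteSpace H] :
    -- the choices made in the construction of `φ_T` are possible
    (∀ T : FredholmZero H,
      (∃ L, IsAdmissible T L) ∧
      (∀ L, IsAdmissible T L → extendByZero T L ∈ regularizers T) ∧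
      Module.finrank ℂ (DetFiber T) = 1) ∧
    -- `φ_T` does not depend on them, and is an isomorphism
    (∀ (T : FredholmZero H) (A A' : regularizers T) (L L' : Ker T →ₗ[ℂ] H)
      (e e' : Module.Basis (Fin (dimKer T)) ℂ (Ker T)),
      IsAdmissible T L → IsAdmissible T L' →
        phi T A L e = phi T A' L' e' ∧ Function.Bijective (phi T A L e)) ∧
    -- the functions `g_{A,B}` are holomorphic on the sets `𝓤_A ∩ 𝓤_B`
    (∀ A B : TraceClass H, DifferentiableOn ℂ (cocycle A.1 B.1)
      {T : H →L[ℂ] H | IsUnit (T + A.1) ∧ IsUnit (T + B.1)}) ∧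
    -- and there are line bundles as follows
    ∃ (φ : ∀ T : FredholmZero H, DetFiber T ≃ₗ[ℂ] QuillenFiber T)
      (Z : VectorBundleCore ℂ (FredholmZero H) ℂ (TraceClass H))
      (SD : LineBundleStructure (DetFiber (H := H)))
      (SQ : LineBundleStructure (QuillenFiber (H := H)))
      (ψ : ∀ T : FredholmZero H, Z.Fiber T ≃ₗ[ℂ] DetFiber T),
      -- `φ T` is the map `φ_T`
      (∀ T A L e, IsAdmissible T L → ∀ f, φ T f = phi T A L e f) ∧
      -- `Z` consists of the sets `𝓤_A` and the cocycle `g_{A,B}`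
      (∀ A, Z.baseSet A = chartDomain A) ∧
      (∀ A B, ∀ T ∈ chartDomain A ∩ chartDomain B, ∀ z : ℂ,
        Z.coordChange A B T z = cocycle A.1 B.1 T.1 * z) ∧
      -- the local trivializations `j_A` of `∐ 𝓓_T`
      (∀ A : TraceClass H, SD.HasTrivialization (chartDomain A)
        (fun _ hT f => f.1 ⟨A.1, A.2, hT⟩)) ∧
      -- the local trivializations `j_A ∘ φ⁻¹` of the Quillen determinant line bundle
      (∀ A : TraceClass H, SQ.HasTrivialization (chartDomain A)
        (fun T hT q => ((φ T).symm q).1 ⟨A.1, A.2, hT⟩)) ∧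
      -- `∐ 𝓓_T` is the bundle defined by the cocycle
      (∀ (A : TraceClass H) (T : FredholmZero H) (hT : T ∈ chartDomain A) (x : Z.Fiber T),
        (Z.localTriv A ⟨T, x⟩).2 = (ψ T x).1 ⟨A.1, A.2, hT⟩) ∧
      IsLineBundleIso (coreLineBundle Z) SD ψ ∧
      -- and both are isomorphic to the Quillen determinant line bundle
      IsLineBundleIso SD SQ φ ∧
      IsLineBundleIso (coreLineBundle Z) SQ (fun T => (ψ T).trans (φ T)) := by
  refine ⟨fun T => ⟨exists_isAdmissible T, fun L hL => extendByZero_mem_regularizers hL,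
    finrank_detFiber T⟩, fun T A A' L L' e e' hL hL' => ⟨phi_eq_phi A A' e e' hL hL',
    phi_bijective A hL e⟩, fun A B T hT =>
    (differentiableAt_cocycle A.2 B.2 hT.2).differentiableWithinAt,
    phiEquiv, determinantCore H, transportLineBundle _ coreFiberEquiv,
    transportLineBundle _ fun T => (coreFiberEquiv T).trans (phiEquiv T), coreFiberEquiv,
    fun T A L e hL f => phiEquiv_apply T A e hL f, fun _ => rfl, fun _ _ _ _ _ => rfl,
    fun A => transportLineBundle_hasTrivialization _ _ A rfl _ fun T hT f => ?_,
    fun A => transportLineBundle_hasTrivialization _ _ A rfl _ fun T hT q => ?_,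
    fun A T hT x => rfl, isLineBundleIso_coreLineBundle _ _,
    isLineBundleIso_transportLineBundle _ _ _, isLineBundleIso_coreLineBundle _ _⟩
  -- Here and in the next goal the transported trivialization is evaluation at `A` after the fibre
  -- isomorphism and its inverse, which cancel.
  · refine (coreFiberEquiv_apply T _ A hT).symm.trans ?_
    rw [LinearEquiv.apply_symm_apply]
  · refine (coreFiberEquiv_apply T _ A hT).symm.trans ?_
    rw [LinearEquiv.trans_symm, LinearEquiv.trans_apply, LinearEquiv.apply_symm_apply]
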